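/- Let $N\ge 1$, ${\bf p}=(p_1,\dots,p_N)$ with $p_i>1$ for every $i$, $0<T\le+\infty$ and $S_T=\mathbb{R}^N\times\,]0,T[$. Let $A: S_T\times\mathbb{R}\times\mathbb{R}^N\to\mathbb{R}^N$ be a (Borel) measurable field such that, for some $\Lambda>0$, for a.e. $(x,t)\in S_T$ and all $s\in\mathbb{R}$, $z\in\mathbb{R}^N$, $i=1,\dots,N$, \[ A_i(x,t,s,z)\,z_i\ge\Lambda^{-1}|z_i|^{p_i},\qquad |A_i(x,t,s,z)|\le\Lambda|z_i|^{p_i-1}. \] Consider, for $u_0:\mathbb{R}^N\to\mathbb{R}$, the Cauchy problem \[ u_t={\rm div}\,A(x,t,u,Du)\ \text{ in } S_T,\qquad u(\cdot,0)=u_0. \tag{1} \] If $T<+\infty$, we say that $u$ solves (1) in $S_T$ if * $u\in C^0([0,T];L^2_{\rm loc}(\mathbb{R}^N))$ and $u(\cdot,0)=u_0$ a.e.; * $u\in L^1(0,T;L^1_{\rm loc}(\mathbb{R}^N))$ and its weak spatial derivatives in $S_T$ satisfy $D_iu\in L^{p_i}(0,T;L^{p_i}_{\rm loc}(\mathbb{R}^N))$,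 $i=1,\dots,N$; * for all $0<t_1<t_2<T$ and every $\varphi\in C^\infty_{\rm loc}(0,T;C^\infty_c(\mathbb{R}^N))$ (that is, $\varphi$ is smooth in $S_T$ and, for every $[a,b]\subset\,]0,T[$, the supports of $\varphi(\cdot,t)$, $t\in[a,b]$, lie in a common compact set), \[ \int_{\mathbb{R}^N}u(x,t_2)\varphi(x,t_2)\,dx-\int_{\mathbb{R}^N}u(x,t_1)\varphi(x,t_1)\,dx+\int_{t_1}^{t_2}\!\!\int_{\mathbb{R}^N}\big(-u\,\varphi_t+A(x,t,u,Du)\cdot D\varphi\big)\,dx\,dt=0 . \] If $T=+\infty$, we say that $u$ solves (1) in $S_T$ if it does so in $S_\tau$ for every finite $\tau>0$. Suppose that $u_0\in L^1(\mathbb{R}^N)\cap L^2(\mathbb{R}^N)$ and that $u\in\bigcap_{i=1}^N L^{p_i}(S_T)$ solves (1) in $S_T$. Then, for every finite $t\in[0,T]$, $u(\cdot,t)\in L^1(\mathbb{R}^N)$ and \[ \int_{\mathbb{R}^N}|u(x,t)|\,dx\le\int_{\mathbb{R}^N}|u_0(x)|\,dx . \] -/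

import Mathlib

open MeasureTheory Set Filter Topology
open scoped ContDiff ENNReal

noncomputable section

namespace AnisotropicParabolic

/-- The space `ℝ^N` with its Euclidean structure and Lebesgue measure. -/
abbrev Sp (N : ℕ) := EuclideanSpace ℝ (Fin N)

/-- The strip `S_T = ℝ^N × ]0, T[`, with `T` possibly infinite. -/
def strip (N : ℕ) (T : EReal) : Set (Sp N × ℝ) :=
  {z | 0 < z.2 ∧ (z.2 : EReal) < T}

/-- The classical spatial derivative `D_i φ` at `z = (x, t)`. -/
def spaceDeriv {N : ℕ} (i : Fin N) (φ : Sp N × ℝ → ℝ) (z : Sp N × ℝ) : ℝ :=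
  fderiv ℝ (fun y : Sp N => φ (y, z.2)) z.1 (EuclideanSpace.single i 1)

/-- The classical time derivative `φ_t` at `z = (x, t)`. -/
def timeDeriv {N : ℕ} (φ : Sp N × ℝ → ℝ) (z : Sp N × ℝ) : ℝ :=
  deriv (fun s : ℝ => φ (z.1, s)) z.2

/-- The field `A : S_T × ℝ × ℝ^N → ℝ^N` is measurable and satisfies, with constant `Λ`,
`A_i(x, t, s, ξ) ξ_i ≥ Λ⁻¹ |ξ_i|^{p_i}` and `|A_i(x, t, s, ξ)| ≤ Λ |ξ_i|^{p_i - 1}`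
for almost every `(x, t) ∈ S_T` and all `s`, `ξ`, `i`. The values of `A` outside `S_T` are never
used. -/
structure IsAdmissibleField {N : ℕ} (p : Fin N → ℝ) (T : EReal) (Λ : ℝ)
    (A : Sp N × ℝ → ℝ → Sp N → Sp N) : Prop where
  measurable : Measurable fun q : (Sp N × ℝ) × ℝ × Sp N => A q.1 q.2.1 q.2.2
  growth : ∀ᵐ z ∂(volume.restrict (strip N T)), ∀ (s : ℝ) (ξ : Sp N) (i : Fin N),
    Λ⁻¹ * |ξ i| ^ p i ≤ A z s ξ i * ξ i ∧ |A z s ξ i| ≤ Λ * |ξ i| ^ (p i - 1)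

/-- `u ∈ C⁰(J; L²_loc(ℝ^N))` for a set `J` of times. -/
def ContinuousInL2Loc {N : ℕ} (J : Set ℝ) (u : Sp N × ℝ → ℝ) : Prop :=
  ∀ K : Set (Sp N), IsCompact K →
    (∀ t ∈ J, MemLp (fun x => u (x, t)) 2 (volume.restrict K)) ∧
    ∀ t₀ ∈ J, Tendsto
      (fun t => eLpNorm (fun x => u (x, t) - u (x, t₀)) 2 (volume.restrict K))
      (𝓝[J] t₀) (𝓝 0)

/-- `f ∈ L^q(J; L^q_loc(ℝ^N))` for a set `J` of times. -/
def MemLpTimeLocSpace {N : ℕ} (q : ℝ) (J : Set ℝ) (f : Sp N × ℝ → ℝ) : Prop :=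
  ∀ K : Set (Sp N), IsCompact K → MemLp f (ENNReal.ofReal q) (volume.restrict (K ×ˢ J))

/-- `G = (D_1 u, …, D_N u)` is the weak spatial gradient of `u` in `S_T`. -/
def IsWeakSpaceGradient {N : ℕ} (T : ℝ) (u : Sp N × ℝ → ℝ) (G : Sp N × ℝ → Sp N) : Prop :=
  ∀ (i : Fin N) (φ : Sp N × ℝ → ℝ), ContDiff ℝ ∞ φ → HasCompactSupport φ →
    tsupport φ ⊆ strip N T →
    ∫ z in strip N T, u z * spaceDeriv i φ z = - ∫ z in strip N T, G z i * φ z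

/-- `u ∈ L^1(J; L^1_loc)` and `D_i u = G_i ∈ L^{p_i}(J; L^{p_i}_loc)` for all `i`. -/
def MemEnergyOn {N : ℕ} (p : Fin N → ℝ) (J : Set ℝ) (u : Sp N × ℝ → ℝ)
    (G : Sp N × ℝ → Sp N) : Prop :=
  MemLpTimeLocSpace 1 J u ∧ ∀ i, MemLpTimeLocSpace (p i) J fun z => G z i

/-- The test functions `C^∞_loc(0, T; C^∞_c(ℝ^N))`: smooth on `ℝ^N × ]0, T[`, with spatial
supports contained in a common compact set as long as `t` stays in a compact subinterval of
`]0, T[`. -/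
def IsTestFunction {N : ℕ} (T : ℝ) (φ : Sp N × ℝ → ℝ) : Prop :=
  ContDiffOn ℝ ∞ φ (strip N T) ∧
  ∀ a b : ℝ, 0 < a → b < T → ∃ K : Set (Sp N), IsCompact K ∧
    ∀ t ∈ Icc a b, ∀ x ∉ K, φ (x, t) = 0

/-- `u`, with weak spatial gradient `G`, is a local weak solution of `u_t = div A(x, t, u, Du)`
in `S_T`, `T < ∞`. -/
structure IsLocalWeakSolution {N : ℕ} (p : Fin N → ℝ) (A : Sp N × ℝ → ℝ → Sp N → Sp N) (T : ℝ)
    (u : Sp N × ℝ → ℝ) (G : Sp N × ℝ → Sp N) : Prop where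
  continuous : ContinuousInL2Loc (Ioo 0 T) u
  gradient : IsWeakSpaceGradient T u G
  energy : ∀ a b : ℝ, 0 < a → b < T → MemEnergyOn p (Icc a b) u G
  equation : ∀ t₁ t₂ : ℝ, 0 < t₁ → t₁ < t₂ → t₂ < T → ∀ φ : Sp N × ℝ → ℝ, IsTestFunction T φ →
    ((∫ x, u (x, t₂) * φ (x, t₂)) - ∫ x, u (x, t₁) * φ (x, t₁))
      + (∫ z in univ ×ˢ Ioo t₁ t₂,
          (-(u z * timeDeriv φ z) + ∑ i, A z (u z) (G z) i * spaceDeriv i φ z)) = 0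

/-- `u` solves the Cauchy problem with datum `u₀` in `S_T`, `T < ∞`: it is a local weak solution
that in addition belongs to `C⁰([0, T]; L²_loc) ∩ L^𝐩(0, T; W^{1,𝐩}_loc)`, with `u(·, 0) = u₀`. -/
def SolvesCauchyFinite {N : ℕ} (p : Fin N → ℝ) (A : Sp N × ℝ → ℝ → Sp N → Sp N) (T : ℝ)
    (u₀ : Sp N → ℝ) (u : Sp N × ℝ → ℝ) : Prop :=
  (∃ G : Sp N × ℝ → Sp N, IsLocalWeakSolution p A T u G ∧ MemEnergyOn p (Ioo 0 T) u G) ∧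
  ContinuousInL2Loc (Icc 0 T) u ∧
  (fun x => u (x, 0)) =ᵐ[volume] u₀

/-- `u` solves the Cauchy problem in `S_T`, `T ∈ ]0, ∞]`; for `T = ∞` this means that it does so
in `S_τ` for every finite `τ > 0`. -/
def SolvesCauchy {N : ℕ} (p : Fin N → ℝ) (A : Sp N × ℝ → ℝ → Sp N → Sp N) (T : EReal)
    (u₀ : Sp N → ℝ) (u : Sp N × ℝ → ℝ) : Prop :=
  (T ≠ ⊤ → SolvesCauchyFinite p A T.toReal u₀ u) ∧
  (T = ⊤ → ∀ τ : ℝ, 0 < τ → SolvesCauchyFinite p A τ u₀ u)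

end AnisotropicParabolic

end

/-! Formally, one tests the equation with `J'(u) ζ ^ m θ`, where `J` is a convex approximation of
`|s|`, `ζ` a spatial cutoff at scale `R`, and `θ` a function of time. Convexity and coercivity make
the gradient term at least a multiple of `∑ |D_i u| ^ p_i ζ ^ m θ`. The term carrying `Dζ` is
bounded by `|D_i u| ^ (p_i - 1) ζ ^ (m - 1) |u| / R` up to constants. Young's inequality absorbs its
gradient part and leaves an error of order `R ^ (-p_i) ∫ |u| ^ p_i` in each direction, which tends
to `0` because `u` lies in every `L^{p_i}(S_T)`. Hence `∫ J(u(t)) ≤ ∫ J(u₀)`. The choice is `J_ε(s)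
= √(ε² + s²) - ε + ε s² / 2`. The quadratic part gives `J_ε'' ≥ ε`, which the absorption needs; its
cost `ε ∫ u₀² / 2` is finite since `u₀ ∈ L²`. The constants blow up as `ε → 0`, so the order of the
limits matters: first `R → ∞` for fixed `ε`, then `ε → 0` on a fixed ball, then the radius of the
ball to infinity. Two points need rigour. First, `J'(u)` is not an admissible test function. With
the flux `a = A(·, u, Du)` frozen, the equation is a linear balance law, so space-time mollification
turns it into a classical one for which the chain rule holds (`entropy_identity_smooth`). All terms
are products of two functions in dual Lebesgue spaces and a bounded factor, so they pass to the
limit (`tendsto_integral_mollify_mul`, `entropy_identity_weak`). Secondly, the resulting inequality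
is weak in time; continuity in `L²_loc` makes it pointwise, down to the initial time
(`le_add_of_weak_derivative`). -/

namespace AnisotropicParabolic

open scoped Convolution

/-! ### Generalized dominated convergence -/

/-- Dominated convergence with a convergent sequence of dominating functions. -/
theorem tendsto_integral_of_convergent_domination {α : Type*} [MeasurableSpace α] {μ : Measure α}
    {F H : ℕ → α → ℝ} {f h : α → ℝ}
    (hFm : ∀ n, AEStronglyMeasurable (F n) μ) (hFH : ∀ n, ∀ᵐ x ∂μ, |F n x| ≤ H n x)
    (hH : ∀ n, Integrable (H n) μ) (hh : Integrable h μ)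
    (hFf : ∀ᵐ x ∂μ, Tendsto (fun n => F n x) atTop (𝓝 (f x)))
    (hHh : ∀ᵐ x ∂μ, Tendsto (fun n => H n x) atTop (𝓝 (h x)))
    (hint : Tendsto (fun n => ∫ x, H n x ∂μ) atTop (𝓝 (∫ x, h x ∂μ))) :
    Tendsto (fun n => ∫ x, F n x ∂μ) atTop (𝓝 (∫ x, f x ∂μ)) := by
  have hFH' := ae_all_iff.2 hFH
  have hfh : ∀ᵐ x ∂μ, |f x| ≤ h x := by
    filter_upwards [hFH', hFf, hHh] with x h1 h2 h3
    exact le_of_tendsto_of_tendsto' h2.abs h3 h1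
  -- Since `0 ≤ H n`, the positive part of `h - H n` is dominated by the fixed function `h`.
  -- Together with convergence of the integrals this forces `H n → h` in `L¹`.
  have hpos : Tendsto (fun n => ∫ x, max (h x - H n x) 0 ∂μ) atTop (𝓝 (∫ _, (0 : ℝ) ∂μ)) := by
    refine tendsto_integral_of_dominated_convergence h
      (fun n => (hh.sub (hH n)).pos_part.aestronglyMeasurable) hh ?_ ?_
    · intro n
      filter_upwards [hFH n, hfh] with x h1 h2
      have a1 := abs_nonneg (F n x)
      have a2 := abs_nonneg (f x)
      rw [Real.norm_eq_abs, abs_of_nonneg (le_max_right _ _)]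
      exact max_le (by linarith) (by linarith)
    · filter_upwards [hHh] with x h1
      have := ((tendsto_const_nhds (x := h x)).sub h1).max (tendsto_const_nhds (x := (0 : ℝ)))
      simpa using this
  have habs : Tendsto (fun n => ∫ x, |H n x - h x| ∂μ) atTop (𝓝 0) := by
    have h1 : ∀ n, ∫ x, |H n x - h x| ∂μ =
        (∫ x, H n x ∂μ) - (∫ x, h x ∂μ) + 2 * ∫ x, max (h x - H n x) 0 ∂μ := by
      intro n
      rw [← integral_sub (hH n) hh, ← integral_const_mul, ← integral_add
        (f := fun x => H n x - h x) (g := fun x => 2 * max (h x - H n x) 0) ((hH n).sub hh)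
        ((hh.sub (hH n)).pos_part.const_mul 2)]
      refine integral_congr_ae (Eventually.of_forall fun x => ?_)
      change |H n x - h x| = H n x - h x + 2 * max (h x - H n x) 0
      rcases le_total (h x) (H n x) with h | h
      · rw [abs_of_nonneg (by linarith), max_eq_right (by linarith)]; ring
      · rw [abs_of_nonpos (by linarith), max_eq_left (by linarith)]; ring
    simp_rw [h1]
    have := (hint.sub_const (∫ x, h x ∂μ)).add (hpos.const_mul 2)
    simpa using this
  -- Truncating `F n` to `[-h, h]` makes ordinary dominated convergence applicable; the truncation
  -- changes `F n` by at most `|H n - h|`.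
  have hclip : Tendsto (fun n => ∫ x, max (-h x) (min (F n x) (h x)) ∂μ) atTop
      (𝓝 (∫ x, f x ∂μ)) := by
    refine tendsto_integral_of_dominated_convergence h
      (fun n => (hh.aestronglyMeasurable.neg.sup ((hFm n).inf hh.aestronglyMeasurable))) hh ?_ ?_
    · intro n
      filter_upwards [hfh] with x h2
      have a2 := abs_nonneg (f x)
      rw [Real.norm_eq_abs, abs_le]
      exact ⟨le_max_left _ _, max_le (by linarith) (min_le_right _ _)⟩
    · filter_upwards [hFf, hfh] with x h1 h2
      have := (tendsto_const_nhds (x := -h x)).max (h1.min (tendsto_const_nhds (x := h x)))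
      rw [abs_le] at h2
      rwa [min_eq_left h2.2, max_eq_right h2.1] at this
  have hFi : ∀ n, Integrable (F n) μ := fun n => (hH n).mono' (hFm n) (hFH n)
  have hci : ∀ n, Integrable (fun x => max (-h x) (min (F n x) (h x))) μ :=
    fun n => hh.neg.sup ((hFi n).inf hh)
  have hdiff : Tendsto (fun n => (∫ x, F n x ∂μ) - ∫ x, max (-h x) (min (F n x) (h x)) ∂μ) atTop
      (𝓝 0) := by
    refine squeeze_zero_norm (fun n => ?_) habs
    rw [← integral_sub (hFi n) (hci n)]
    refine norm_integral_le_of_norm_le ((hH n).sub hh).abs ?_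
    filter_upwards [hFH n, hfh] with x h1 h2
    have a2 := abs_nonneg (f x)
    rw [Real.norm_eq_abs]
    rw [abs_le] at h1
    rcases le_total (F n x) (h x) with h3 | h3
    · rw [min_eq_left h3]
      rcases le_total (-h x) (F n x) with h4 | h4
      · rw [max_eq_right h4, sub_self, abs_zero]; exact abs_nonneg _
      · rw [max_eq_left h4, abs_of_nonpos (by linarith)]
        exact le_trans (by linarith) (le_abs_self _)
    · rw [min_eq_right h3, max_eq_right (by linarith), abs_of_nonneg (by linarith)]
      exact le_trans (by linarith) (le_abs_self _)
  simpa using hdiff.add hclip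

/-! ### Mollification and limits of products -/

section Mollify

variable {X : Type*} [NormedAddCommGroup X] [NormedSpace ℝ X] [FiniteDimensional ℝ X]
  [MeasureSpace X] [BorelSpace X] [(volume : Measure X).IsAddHaarMeasure]

/-- The mollification `ρ ⋆ f` of `f` by the normalized bump function `ρ`. -/
noncomputable def mollify (φ : ContDiffBump (0 : X)) (f : X → ℝ) : X → ℝ :=
  φ.normed volume ⋆[ContinuousLinearMap.lsmul ℝ ℝ, volume] f

theorem mollify_apply (φ : ContDiffBump (0 : X)) (f : X → ℝ) (x : X) :
    mollify φ f x = ∫ y, φ.normed volume (x - y) * f y := by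
  rw [mollify, convolution_eq_swap]; rfl

theorem integrable_mollify_integrand (φ : ContDiffBump (0 : X)) {f : X → ℝ}
    (hf : LocallyIntegrable f volume) (x : X) :
    Integrable (fun y => φ.normed volume (x - y) * f y) := by
  have := hf.integrable_smul_left_of_hasCompactSupport
    (g := fun y => φ.normed volume (x - y)) (by have := φ.continuous_normed (μ := volume); fun_prop)
    (φ.hasCompactSupport_normed.comp_homeomorph (Homeomorph.subLeft x))
  simpa using this

theorem integral_normed_sub (φ : ContDiffBump (0 : X)) (x : X) :
    ∫ y, φ.normed volume (x - y) = 1 := by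
  rw [integral_sub_left_eq_self (fun y => φ.normed volume y) volume x, φ.integral_normed]

theorem contDiff_mollify (φ : ContDiffBump (0 : X)) {f : X → ℝ}
    (hf : LocallyIntegrable f volume) {n : ℕ∞} : ContDiff ℝ n (mollify φ f) :=
  φ.hasCompactSupport_normed.contDiff_convolution_left _ φ.contDiff_normed hf

/-- The derivative falls on the kernel, so it can be read as the pairing of `f` with a test
function. -/
theorem fderiv_mollify (φ : ContDiffBump (0 : X)) {f : X → ℝ}
    (hf : LocallyIntegrable f volume) (x v : X) :
    fderiv ℝ (mollify φ f) x v = ∫ y, fderiv ℝ (φ.normed volume) (x - y) v * f y := by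
  have h := φ.hasCompactSupport_normed.hasFDerivAt_convolution_left
    (ContinuousLinearMap.lsmul ℝ ℝ) (φ.contDiff_normed (μ := volume)) hf x
  have he := (φ.hasCompactSupport_normed.fderiv ℝ).convolutionExists_left
    ((ContinuousLinearMap.lsmul ℝ ℝ).precompL X)
    ((φ.contDiff_normed (μ := volume) (n := 1)).continuous_fderiv one_ne_zero) hf x
  rw [mollify, h.fderiv, convolution_eq_swap, ContinuousLinearMap.integral_apply
    he.integrable_swap]
  rfl

theorem integral_mollify (φ : ContDiffBump (0 : X)) {f : X → ℝ} (hf : Integrable f) :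
    ∫ x, mollify φ f x = ∫ x, f x := by
  rw [mollify, integral_convolution (ContinuousLinearMap.lsmul ℝ ℝ) φ.integrable_normed hf,
    φ.integral_normed]
  simp

theorem integrable_mollify (φ : ContDiffBump (0 : X)) {f : X → ℝ} (hf : Integrable f) :
    Integrable (mollify φ f) :=
  φ.integrable_normed.integrable_convolution _ hf

/-- Jensen's inequality for mollifications. -/
theorem abs_mollify_rpow_le (φ : ContDiffBump (0 : X)) {f : X → ℝ} {p : ℝ} (hp : 1 ≤ p)
    (hf : LocallyIntegrable f volume) (hfp : LocallyIntegrable (fun x => |f x| ^ p) volume)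
    (x : X) : |mollify φ f x| ^ p ≤ mollify φ (fun y => |f y| ^ p) x := by
  set w : X → ℝ := fun y => φ.normed volume (x - y) with hw
  have hwc : Continuous w := by have := φ.continuous_normed (μ := volume); fun_prop
  have hw0 : ∀ y, 0 ≤ w y := fun y => φ.nonneg_normed _
  have hwi : Integrable w := φ.integrable_normed.comp_sub_left x
  -- The kernel centred at `x` is a probability density, so Jensen's inequality applies to this
  -- measure.
  let ν : Measure X := volume.withDensity fun y => ENNReal.ofReal (w y)
  have hν : IsProbabilityMeasure ν := by
    constructor
    rw [withDensity_apply _ MeasurableSet.univ, Measure.restrict_univ,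
      ← ofReal_integral_eq_lintegral_ofReal hwi (Eventually.of_forall hw0),
      integral_normed_sub, ENNReal.ofReal_one]
  have hmeas : Measurable fun y => (w y).toNNReal := hwc.measurable.real_toNNReal
  have hνint : ∀ g : X → ℝ, ∫ y, g y ∂ν = ∫ y, w y * g y := by
    intro g
    have := integral_withDensity_eq_integral_smul (μ := volume) hmeas g
    refine this.trans (integral_congr_ae (Eventually.of_forall fun y => ?_))
    simp [NNReal.smul_def, Real.coe_toNNReal _ (hw0 y)]
  have hνi : ∀ g : X → ℝ, LocallyIntegrable g volume → Integrable g ν := by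
    intro g hg
    refine (integrable_withDensity_iff_integrable_smul (μ := volume) hmeas).2 ?_
    refine (integrable_mollify_integrand φ hg x).congr (Eventually.of_forall fun y => ?_)
    simp only [NNReal.smul_def, Real.coe_toNNReal _ (hw0 y), smul_eq_mul]
    rfl
  have hJ := (convexOn_rpow hp).map_integral_le (μ := ν) (f := fun y => |f y|)
    (Real.continuous_rpow_const (by linarith)).continuousOn isClosed_Ici
    (Eventually.of_forall fun y => mem_Ici.2 (abs_nonneg _))
    (hνi f hf).abs (hνi _ hfp)
  rw [mollify_apply, mollify_apply, ← hνint]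
  refine le_trans ?_ (hJ.trans (hνint _).le)
  exact Real.rpow_le_rpow (abs_nonneg _) (abs_integral_le_integral_abs) (by linarith)

/-- Convergence of the integral of a product of mollifications in dual Lebesgue spaces,
with a bounded weight converging almost everywhere. -/
theorem tendsto_integral_mollify_mul {φ : ℕ → ContDiffBump (0 : X)} {K : ℝ}
    (hφ : Tendsto (fun n => (φ n).rOut) atTop (𝓝 0))
    (hφK : ∀ n, (φ n).rOut ≤ K * (φ n).rIn)
    {p q : ℝ} (hpq : p.HolderConjugate q) {f g : X → ℝ}
    (hf : LocallyIntegrable f volume) (hg : LocallyIntegrable g volume)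
    (hfp : Integrable fun x => |f x| ^ p) (hgq : Integrable fun x => |g x| ^ q)
    {ψ : ℕ → X → ℝ} {ψ₀ : X → ℝ} {C : ℝ} (hψm : ∀ n, AEStronglyMeasurable (ψ n) volume)
    (hψC : ∀ n x, |ψ n x| ≤ C)
    (hψ : ∀ᵐ x, Tendsto (fun n => ψ n x) atTop (𝓝 (ψ₀ x))) :
    (∀ n, Integrable fun x => mollify (φ n) f x * mollify (φ n) g x * ψ n x) ∧
    (Integrable fun x => f x * g x * ψ₀ x) ∧
    Tendsto (fun n => ∫ x, mollify (φ n) f x * mollify (φ n) g x * ψ n x) atTop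
      (𝓝 (∫ x, f x * g x * ψ₀ x)) := by
  set h : X → ℝ := fun x => |f x| ^ p + |g x| ^ q with hh
  have hhi : Integrable h := hfp.add hgq
  have hlim : ∀ {k : X → ℝ}, LocallyIntegrable k volume →
      ∀ᵐ x, Tendsto (fun n => mollify (φ n) k x) atTop (𝓝 (k x)) := fun hk =>
    ContDiffBump.ae_convolution_tendsto_right_of_locallyIntegrable hφ
      (Eventually.of_forall hφK) hk
  have hC : ∀ x : X, 0 ≤ C := fun x => (abs_nonneg _).trans (hψC 0 x)
  -- Young's inequality followed by Jensen's: the product is dominated by the mollification of one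
  -- fixed integrable function.
  have hbound : ∀ n x, |mollify (φ n) f x * mollify (φ n) g x * ψ n x|
      ≤ C * mollify (φ n) h x := by
    intro n x
    have h1 := abs_mollify_rpow_le (φ n) hpq.lt.le hf hfp.locallyIntegrable x
    have h2 := abs_mollify_rpow_le (φ n) hpq.symm.lt.le hg hgq.locallyIntegrable x
    have h3 : mollify (φ n) h x = mollify (φ n) (fun y => |f y| ^ p) x
        + mollify (φ n) (fun y => |g y| ^ q) x := by
      simp only [mollify_apply, hh, mul_add]
      exact integral_add (integrable_mollify_integrand (φ n) hfp.locallyIntegrable x)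
        (integrable_mollify_integrand (φ n) hgq.locallyIntegrable x)
    have h4 := Real.young_inequality (|mollify (φ n) f x|) (|mollify (φ n) g x|) hpq
    rw [abs_abs, abs_abs] at h4
    have h5 : |mollify (φ n) f x| ^ p / p ≤ |mollify (φ n) f x| ^ p :=
      div_le_self (by positivity) hpq.lt.le
    have h6 : |mollify (φ n) g x| ^ q / q ≤ |mollify (φ n) g x| ^ q :=
      div_le_self (by positivity) hpq.symm.lt.le
    rw [abs_mul, abs_mul, mul_comm]
    exact mul_le_mul (hψC n x) (by linarith) (by positivity) (hC x)
  have hm : ∀ n, AEStronglyMeasurable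
      (fun x => mollify (φ n) f x * mollify (φ n) g x * ψ n x) volume := fun n =>
    (((contDiff_mollify (n := 0) (φ n) hf).continuous.mul
      (contDiff_mollify (n := 0) (φ n) hg).continuous).aestronglyMeasurable).mul (hψm n)
  have hae : ∀ᵐ x, Tendsto (fun n => mollify (φ n) f x * mollify (φ n) g x * ψ n x) atTop
      (𝓝 (f x * g x * ψ₀ x)) := by
    filter_upwards [hlim hf, hlim hg, hψ] with x h1 h2 h3
    exact (h1.mul h2).mul h3
  have haeh : ∀ᵐ x, Tendsto (fun n => C * mollify (φ n) h x) atTop (𝓝 (C * h x)) := by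
    filter_upwards [hlim hhi.locallyIntegrable] with x h1
    exact h1.const_mul C
  refine ⟨fun n => ((integrable_mollify (φ n) hhi).const_mul C).mono' (hm n)
    (Eventually.of_forall (hbound n)), (hhi.const_mul C).mono'
      (aestronglyMeasurable_of_tendsto_ae atTop hm hae) ?_, ?_⟩
  · filter_upwards [hae, haeh] with x h1 h2
    exact le_of_tendsto_of_tendsto' h1.norm h2 fun n => hbound n x
  refine tendsto_integral_of_convergent_domination (H := fun n x => C * mollify (φ n) h x)
    (h := fun x => C * h x) hm
    (fun n => Eventually.of_forall (hbound n))
    (fun n => (integrable_mollify (φ n) hhi).const_mul C) (hhi.const_mul C) hae haeh ?_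
  -- Mollification preserves the integral, so the integrals of the dominating functions do not
  -- depend on `n`.
  · simp_rw [integral_const_mul, integral_mollify _ hhi]
    exact tendsto_const_nhds

/-- The integral of a directional derivative of a compactly supported function vanishes. -/
theorem integral_fderiv_eq_zero {F : X → ℝ} (hF : ContDiff ℝ 1 F) (hc : HasCompactSupport F)
    (v : X) : ∫ x, fderiv ℝ F x v = 0 := by
  have hi : Integrable fun x => fderiv ℝ F x v := by
    refine Continuous.integrable_of_hasCompactSupport ?_ ?_
    · exact (hF.continuous_fderiv one_ne_zero).clm_apply continuous_const
    · exact hc.fderiv_apply ℝ v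
  have := integral_mul_fderiv_eq_neg_fderiv_mul_of_integrable (μ := (volume : Measure X))
    (f := fun _ => (1 : ℝ)) (g := F) (v := v) (by simp) (by simpa using hi)
    (by simpa using hF.continuous.integrable_of_hasCompactSupport hc)
    (fun x _ => differentiableAt_const _) (fun x _ => hF.differentiable one_ne_zero x)
  simpa using this

end Mollify

/-! ### Entropies and weak balance laws -/

/-- A convex entropy `J` with `J' s = s * σ s`, `J'' = τ` and `J s = s ^ 2 * j s`, where `σ`, `τ`
and `j` are continuous and bounded by `B`. -/
structure IsEntropy (J σ τ j : ℝ → ℝ) (B : ℝ) : Prop where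
  hasDerivAt : ∀ s, HasDerivAt J (s * σ s) s
  hasDerivAt_deriv : ∀ s, HasDerivAt (fun s => s * σ s) (τ s) s
  eq_mul : ∀ s, J s = s * s * j s
  continuous_σ : Continuous σ
  continuous_τ : Continuous τ
  continuous_j : Continuous j
  abs_σ_le : ∀ s, |σ s| ≤ B
  abs_τ_le : ∀ s, |τ s| ≤ B
  abs_j_le : ∀ s, |j s| ≤ B

namespace IsEntropy

variable {J σ τ j : ℝ → ℝ} {B : ℝ}

theorem contDiff (h : IsEntropy J σ τ j B) : ContDiff ℝ 1 J := by
  rw [contDiff_one_iff_deriv]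
  refine ⟨fun s => (h.hasDerivAt s).differentiableAt, ?_⟩
  rw [show deriv J = fun s => s * σ s from funext fun s => (h.hasDerivAt s).deriv]
  exact continuous_id.mul h.continuous_σ

theorem contDiff_deriv (h : IsEntropy J σ τ j B) :
    ContDiff ℝ 1 fun s => s * σ s := by
  rw [contDiff_one_iff_deriv]
  refine ⟨fun s => (h.hasDerivAt_deriv s).differentiableAt, ?_⟩
  rw [show deriv (fun s => s * σ s) = τ from funext fun s => (h.hasDerivAt_deriv s).deriv]
  exact h.continuous_τ

theorem continuous (h : IsEntropy J σ τ j B) : Continuous J := h.contDiff.continuous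

theorem nonneg_bound (h : IsEntropy J σ τ j B) : 0 ≤ B := (abs_nonneg _).trans (h.abs_σ_le 0)

end IsEntropy

theorem continuous_fderiv_apply_of_contDiff_one {X : Type*} [NormedAddCommGroup X]
    [NormedSpace ℝ X] {F : X → ℝ} (hF : ContDiff ℝ 1 F) (v : X) :
    Continuous fun x => fderiv ℝ F x v :=
  (hF.continuous_fderiv one_ne_zero).clm_apply continuous_const

section BalanceLaw

variable {X : Type*} [NormedAddCommGroup X] [NormedSpace ℝ X] [FiniteDimensional ℝ X]
  [MeasureSpace X] [BorelSpace X] [(volume : Measure X).IsAddHaarMeasure]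

/-- The entropy identity for a smooth solution of `∂_w U = ∑ ∂_{e_i} V_i`. -/
theorem entropy_identity_smooth {ι : Type*} [Fintype ι] {J σ τ j : ℝ → ℝ} {B : ℝ}
    (hE : IsEntropy J σ τ j B) (w : X) (e : ι → X) {U χ : X → ℝ} {V : ι → X → ℝ}
    (hU : ContDiff ℝ 1 U) (hV : ∀ i, ContDiff ℝ 1 (V i)) (hχ : ContDiff ℝ 1 χ)
    (hχc : HasCompactSupport χ)
    (heq : ∀ z, χ z ≠ 0 → fderiv ℝ U z w = ∑ i, fderiv ℝ (V i) z (e i)) :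
    ∫ z, U z * U z * (j (U z) * fderiv ℝ χ z w) =
      ∑ i, ((∫ z, V i z * U z * (σ (U z) * fderiv ℝ χ z (e i))) +
        ∫ z, V i z * fderiv ℝ U z (e i) * (τ (U z) * χ z)) := by
  have hUd : Differentiable ℝ U := hU.differentiable one_ne_zero
  have hVd : ∀ i, Differentiable ℝ (V i) := fun i => (hV i).differentiable one_ne_zero
  have hχd : Differentiable ℝ χ := hχ.differentiable one_ne_zero
  have hSd : ∀ z, HasFDerivAt (fun z => U z * σ (U z)) (τ (U z) • fderiv ℝ U z) z := fun z =>
    (hE.hasDerivAt_deriv (U z)).comp_hasFDerivAt z (hUd z).hasFDerivAt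
  have hJd : ∀ z, HasFDerivAt (fun z => J (U z)) ((U z * σ (U z)) • fderiv ℝ U z) z := fun z =>
    (hE.hasDerivAt (U z)).comp_hasFDerivAt z (hUd z).hasFDerivAt
  have hχv : ∀ v : X, HasCompactSupport fun z => fderiv ℝ χ z v := fun v => hχc.fderiv_apply ℝ v
  have hUc := hU.continuous
  have hσ := hE.continuous_σ
  have hτ := hE.continuous_τ
  have hj := hE.continuous_j
  have hχcont := hχ.continuous
  have hχ' := fun v => continuous_fderiv_apply_of_contDiff_one hχ v
  have hU' := fun v => continuous_fderiv_apply_of_contDiff_one hU v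
  have hV' := fun i v => continuous_fderiv_apply_of_contDiff_one (hV i) v
  have hVc := fun i => (hV i).continuous
  have i1 : Integrable fun z => U z * U z * (j (U z) * fderiv ℝ χ z w) := by
    have := hχ' w
    exact Continuous.integrable_of_hasCompactSupport (by fun_prop) ((hχv w).mul_left.mul_left)
  have i2 : Integrable fun z => χ z * (U z * σ (U z)) * fderiv ℝ U z w := by
    have := hU' w
    exact Continuous.integrable_of_hasCompactSupport (by fun_prop) (hχc.mul_right.mul_right)
  have i3 : ∀ i, Integrable fun z => V i z * U z * (σ (U z) * fderiv ℝ χ z (e i)) := fun i => by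
    have := hχ' (e i)
    have := hVc i
    exact Continuous.integrable_of_hasCompactSupport (by fun_prop)
      ((hχv (e i)).mul_left.mul_left)
  have i4 : ∀ i, Integrable fun z => V i z * fderiv ℝ U z (e i) * (τ (U z) * χ z) := fun i => by
    have := hU' (e i)
    have := hVc i
    exact Continuous.integrable_of_hasCompactSupport (by fun_prop) (hχc.mul_left.mul_left)
  have i5 : ∀ i, Integrable fun z => χ z * (U z * σ (U z)) * fderiv ℝ (V i) z (e i) := fun i => by
    have := hV' i (e i)
    exact Continuous.integrable_of_hasCompactSupport (by fun_prop) (hχc.mul_right.mul_right)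
  -- The integral of `∂_w (χ J(U))` vanishes.
  have t0 : (∫ z, U z * U z * (j (U z) * fderiv ℝ χ z w)) +
      ∫ z, χ z * (U z * σ (U z)) * fderiv ℝ U z w = 0 := by
    rw [← integral_add i1 i2, ← integral_fderiv_eq_zero (F := fun z => χ z * J (U z))
      (hχ.mul (hE.contDiff.comp hU)) hχc.mul_right w]
    refine integral_congr_ae (Eventually.of_forall fun z => ?_)
    have := ((hχd z).hasFDerivAt.mul (hJd z)).fderiv
    change _ = fderiv ℝ (χ * fun z => J (U z)) z w
    rw [this]
    simp [hE.eq_mul]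
    ring
  -- The integral of `∂_{e_i} (χ J'(U) V_i)` vanishes.
  have ti : ∀ i, ((∫ z, V i z * U z * (σ (U z) * fderiv ℝ χ z (e i))) +
        ∫ z, V i z * fderiv ℝ U z (e i) * (τ (U z) * χ z)) =
      - ∫ z, χ z * (U z * σ (U z)) * fderiv ℝ (V i) z (e i) := by
    intro i
    rw [eq_neg_iff_add_eq_zero, ← integral_add (i3 i) (i4 i), ← integral_add
      (f := fun z => V i z * U z * (σ (U z) * fderiv ℝ χ z (e i)) +
        V i z * fderiv ℝ U z (e i) * (τ (U z) * χ z)) ((i3 i).add (i4 i)) (i5 i),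
      ← integral_fderiv_eq_zero
      (F := fun z => (χ z * (U z * σ (U z))) * V i z)
      ((hχ.mul (hE.contDiff_deriv.comp hU)).mul (hV i)) hχc.mul_right.mul_right (e i)]
    refine integral_congr_ae (Eventually.of_forall fun z => ?_)
    have := (((hχd z).hasFDerivAt.mul (hSd z)).mul (hVd i z).hasFDerivAt).fderiv
    change _ = fderiv ℝ ((χ * fun z => U z * σ (U z)) * V i) z (e i)
    rw [this]
    simp
    ring
  have hsum : ∫ z, χ z * (U z * σ (U z)) * fderiv ℝ U z w =
      ∑ i, ∫ z, χ z * (U z * σ (U z)) * fderiv ℝ (V i) z (e i) := by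
    rw [← integral_finsetSum _ fun i _ => i5 i]
    refine integral_congr_ae (Eventually.of_forall fun z => ?_)
    change _ = ∑ i, χ z * (U z * σ (U z)) * fderiv ℝ (V i) z (e i)
    rw [← Finset.mul_sum]
    by_cases hz : χ z = 0
    · simp [hz]
    · change χ z * (U z * σ (U z)) * fderiv ℝ U z w = _
      rw [heq z hz]
  rw [Finset.sum_congr rfl fun i _ => ti i, Finset.sum_neg_distrib, ← hsum]
  linarith

/-- A translated reflection of a bump function is an admissible test function. -/
theorem reflected_bump_props (φ : ContDiffBump (0 : X)) (z : X) {O : Set X}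
    (hz : Metric.closedBall z φ.rOut ⊆ O) :
    ContDiff ℝ ∞ (fun y => φ.normed volume (z - y)) ∧
    HasCompactSupport (fun y => φ.normed volume (z - y)) ∧
    tsupport (fun y => φ.normed volume (z - y)) ⊆ O ∧
    ∀ y v, fderiv ℝ (fun y => φ.normed volume (z - y)) y v =
      - fderiv ℝ (φ.normed volume) (z - y) v := by
  refine ⟨φ.contDiff_normed.comp (contDiff_const.sub contDiff_id),
    φ.hasCompactSupport_normed.comp_homeomorph (Homeomorph.subLeft z), ?_, ?_⟩
  · refine (closure_minimal ?_ Metric.isClosed_closedBall).trans hz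
    intro y hy
    have : z - y ∈ Function.support (φ.normed (volume : Measure X)) := hy
    rw [φ.support_normed_eq, mem_ball_zero_iff] at this
    rw [Metric.mem_closedBall, dist_eq_norm, norm_sub_rev]
    exact this.le
  · intro y v
    have h1 : DifferentiableAt ℝ (φ.normed volume) (z - y) :=
      (φ.contDiff_normed (n := 1)).differentiable one_ne_zero _
    have h2 := h1.hasFDerivAt.comp y ((hasFDerivAt_id y).const_sub z)
    have h3 := h2.fderiv
    change fderiv ℝ (φ.normed volume ∘ HSub.hSub z) y v = _
    rw [h3]
    simp

/-- Mollification commutes with weak directional derivatives. -/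
theorem fderiv_mollify_of_weak {O : Set X} {u g : X → ℝ} {v : X}
    (hu : LocallyIntegrable u volume)
    (hweak : ∀ ψ : X → ℝ, ContDiff ℝ ∞ ψ → HasCompactSupport ψ → tsupport ψ ⊆ O →
      ∫ z, u z * fderiv ℝ ψ z v = - ∫ z, g z * ψ z)
    (φ : ContDiffBump (0 : X)) {z : X} (hz : Metric.closedBall z φ.rOut ⊆ O) :
    fderiv ℝ (mollify φ u) z v = mollify φ g z := by
  obtain ⟨h1, h2, h3, h4⟩ := reflected_bump_props φ z hz
  have h5 := hweak _ h1 h2 h3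
  rw [fderiv_mollify φ hu, mollify_apply]
  simp_rw [h4, mul_neg, integral_neg, neg_inj] at h5
  simp_rw [mul_comm _ (u _), mul_comm _ (g _)]
  exact h5

/-- Mollification preserves a weak balance law. -/
theorem fderiv_mollify_of_balance {ι : Type*} [Fintype ι] {O : Set X} {u : X → ℝ}
    {a : ι → X → ℝ} {w : X} {e : ι → X} (hu : LocallyIntegrable u volume)
    (ha : ∀ i, LocallyIntegrable (a i) volume)
    (hweak : ∀ ψ : X → ℝ, ContDiff ℝ ∞ ψ → HasCompactSupport ψ → tsupport ψ ⊆ O →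
      ∫ z, u z * fderiv ℝ ψ z w = ∑ i, ∫ z, a i z * fderiv ℝ ψ z (e i))
    (φ : ContDiffBump (0 : X)) {z : X} (hz : Metric.closedBall z φ.rOut ⊆ O) :
    fderiv ℝ (mollify φ u) z w = ∑ i, fderiv ℝ (mollify φ (a i)) z (e i) := by
  obtain ⟨h1, h2, h3, h4⟩ := reflected_bump_props φ z hz
  have h5 := hweak _ h1 h2 h3
  rw [fderiv_mollify φ hu, Finset.sum_congr rfl fun i _ => fderiv_mollify φ (ha i) z (e i)]
  simp_rw [h4, mul_neg, integral_neg, Finset.sum_neg_distrib, neg_inj] at h5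
  simp_rw [mul_comm _ (u _), mul_comm _ (a _ _)]
  exact h5

/-- The entropy identity for weak solutions of `∂_w u = ∑ ∂_{e_i} a_i` with `∂_{e_i} u = G_i`,
when `G_i` and `a_i` belong to dual Lebesgue spaces. -/
theorem entropy_identity_weak {ι : Type*} [Fintype ι] {J σ τ j : ℝ → ℝ} {B : ℝ}
    (hE : IsEntropy J σ τ j B) {w : X} {e : ι → X} {O : Set X} (hO : IsOpen O) {p q : ι → ℝ}
    (hpq : ∀ i, (q i).HolderConjugate (p i)) {u : X → ℝ} {a G : ι → X → ℝ}
    (hu : LocallyIntegrable u volume) (hG : ∀ i, LocallyIntegrable (G i) volume)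
    (ha : ∀ i, LocallyIntegrable (a i) volume) (hu2 : Integrable fun z => |u z| ^ (2 : ℝ))
    (hup : ∀ i, Integrable fun z => |u z| ^ p i) (hGp : ∀ i, Integrable fun z => |G i z| ^ p i)
    (haq : ∀ i, Integrable fun z => |a i z| ^ q i)
    (hgrad : ∀ i, ∀ ψ : X → ℝ, ContDiff ℝ ∞ ψ → HasCompactSupport ψ → tsupport ψ ⊆ O →
      ∫ z, u z * fderiv ℝ ψ z (e i) = - ∫ z, G i z * ψ z)
    (hbal : ∀ ψ : X → ℝ, ContDiff ℝ ∞ ψ → HasCompactSupport ψ → tsupport ψ ⊆ O →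
      ∫ z, u z * fderiv ℝ ψ z w = ∑ i, ∫ z, a i z * fderiv ℝ ψ z (e i))
    {χ : X → ℝ} (hχ : ContDiff ℝ 1 χ) (hχc : HasCompactSupport χ) (hχO : tsupport χ ⊆ O) :
    (Integrable fun z => u z * u z * (j (u z) * fderiv ℝ χ z w)) ∧
    (∀ i, Integrable fun z => a i z * u z * (σ (u z) * fderiv ℝ χ z (e i))) ∧
    (∀ i, Integrable fun z => a i z * G i z * (τ (u z) * χ z)) ∧
    ∫ z, u z * u z * (j (u z) * fderiv ℝ χ z w) =
      ∑ i, ((∫ z, a i z * u z * (σ (u z) * fderiv ℝ χ z (e i))) +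
        ∫ z, a i z * G i z * (τ (u z) * χ z)) := by
  -- With mollification radii at most `r`, every kernel centred on the support of `χ` is an
  -- admissible test function in `O`; the mollified equations are needed only there.
  obtain ⟨r, hr, hrO⟩ := hχc.isCompact.exists_cthickening_subset_open hO hχO
  -- The ratio of outer to inner radius is kept fixed, as required for almost everywhere convergence
  -- of the mollifications.
  let φ : ℕ → ContDiffBump (0 : X) := fun n =>
    { rIn := r / 2 / (n + 1)
      rOut := r / (n + 1)
      rIn_pos := by positivity
      rIn_lt_rOut := by
        rw [div_div, mul_comm, ← div_div]
        exact half_lt_self (by positivity) }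
  have hφ : Tendsto (fun n => (φ n).rOut) atTop (𝓝 0) := by
    have := (tendsto_one_div_add_atTop_nhds_zero_nat (𝕜 := ℝ)).const_mul r
    simpa [φ, div_eq_mul_inv] using this
  have hφK : ∀ n, (φ n).rOut ≤ 2 * (φ n).rIn := fun n => by
    change r / (n + 1) ≤ 2 * (r / 2 / (n + 1))
    apply le_of_eq; ring
  have hball : ∀ n, ∀ z ∈ tsupport χ, Metric.closedBall z (φ n).rOut ⊆ O := fun n z hz => by
    refine (Metric.closedBall_subset_closedBall ?_).trans
      ((Metric.closedBall_subset_cthickening hz r).trans hrO)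
    exact div_le_self hr.le (by linarith [(Nat.cast_nonneg n : (0 : ℝ) ≤ n)])
  have hsm : ∀ n {f : X → ℝ}, LocallyIntegrable f volume → ContDiff ℝ 1 (mollify (φ n) f) :=
    fun n f hf => contDiff_mollify (n := 1) (φ n) hf
  have hulim : ∀ᵐ x, Tendsto (fun n => mollify (φ n) u x) atTop (𝓝 (u x)) :=
    ContDiffBump.ae_convolution_tendsto_right_of_locallyIntegrable hφ
      (Eventually.of_forall hφK) hu
  have hχ' := fun v => continuous_fderiv_apply_of_contDiff_one hχ v
  have hbd : ∀ {k : X → ℝ}, Continuous k → HasCompactSupport k → ∃ C, ∀ x, |k x| ≤ C :=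
    fun hk hkc => hkc.exists_bound_of_continuous hk
  -- One limit serves all three kinds of term: `u · u` with exponents `2, 2`, and `a_i · u` and `a_i
  -- · G_i` with exponents `q_i, p_i`. The remaining factor is a bounded continuous function of `u`
  -- times a compactly supported one.
  have key : ∀ {f g k : X → ℝ} {s : ℝ → ℝ} {p q : ℝ}, p.HolderConjugate q →
      LocallyIntegrable f volume → LocallyIntegrable g volume →
      (Integrable fun x => |f x| ^ p) → (Integrable fun x => |g x| ^ q) →
      Continuous k → HasCompactSupport k → Continuous s → (∀ r, |s r| ≤ B) →
      (Integrable fun x => f x * g x * (s (u x) * k x)) ∧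
      Tendsto (fun n => ∫ x, mollify (φ n) f x * mollify (φ n) g x *
        (s (mollify (φ n) u x) * k x)) atTop (𝓝 (∫ x, f x * g x * (s (u x) * k x))) := by
    intro f g k s p q hpq hf hg hfp hgq hk hkc hs hsB
    obtain ⟨C, hC⟩ := hbd hk hkc
    refine (tendsto_integral_mollify_mul hφ hφK hpq hf hg hfp hgq (C := B * C)
      (fun n => (((hs.comp (hsm n hu).continuous)).mul hk).aestronglyMeasurable) ?_ ?_).2
    · intro n x
      change |s (mollify (φ n) u x) * k x| ≤ B * C
      rw [abs_mul]
      exact mul_le_mul (hsB _) (hC x) (abs_nonneg _) hE.nonneg_bound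
    · filter_upwards [hulim] with x hx
      exact ((hs.tendsto _).comp hx).mul_const _
  obtain ⟨a1, a2⟩ := key (p := 2) (q := 2) Real.HolderConjugate.two_two hu hu hu2 hu2 (hχ' w)
    (hχc.fderiv_apply ℝ w) hE.continuous_j hE.abs_j_le
  have b := fun i => key (hpq i) (ha i) hu (haq i) (hup i) (hχ' (e i))
    (hχc.fderiv_apply ℝ (e i)) hE.continuous_σ hE.abs_σ_le
  have c := fun i => key (hpq i) (ha i) (hG i) (haq i) (hGp i) hχ.continuous hχc
    hE.continuous_τ hE.abs_τ_le
  refine ⟨a1, fun i => (b i).1, fun i => (c i).1, tendsto_nhds_unique a2 ?_⟩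
  refine (tendsto_finsetSum _ fun i _ => (b i).2.add (c i).2).congr fun n => ?_
  rw [entropy_identity_smooth hE w e (hsm n hu) (fun i => hsm n (ha i)) hχ hχc
    fun z hz => fderiv_mollify_of_balance hu ha hbal (φ n)
      (hball n z (subset_tsupport _ hz))]
  refine Finset.sum_congr rfl fun i _ => ?_
  congr 1
  refine integral_congr_ae (Eventually.of_forall fun z => ?_)
  by_cases hz : χ z = 0
  · simp [hz]
  · change _ = _ * fderiv ℝ (mollify (φ n) u) z (e i) * _
    rw [fderiv_mollify_of_weak hu (hgrad i) (φ n) (hball n z (subset_tsupport _ hz))]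

end BalanceLaw

/-! ### The entropy identity for the parabolic equation -/

instance isAddHaarMeasure_volume_prod (N : ℕ) :
    (volume : Measure (Sp N × ℝ)).IsAddHaarMeasure := by
  rw [Measure.volume_eq_prod]
  infer_instance

theorem strip_coe (N : ℕ) (T : ℝ) : strip N (T : EReal) = univ ×ˢ Ioo 0 T := by
  ext z
  simp [strip]

theorem spaceDeriv_eq {N : ℕ} (i : Fin N) {φ : Sp N × ℝ → ℝ} {z : Sp N × ℝ}
    (h : DifferentiableAt ℝ φ z) :
    spaceDeriv i φ z = fderiv ℝ φ z (EuclideanSpace.single i 1, 0) := by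
  have h1 : HasFDerivAt (fun y : Sp N => (y, z.2)) (ContinuousLinearMap.inl ℝ (Sp N) ℝ) z.1 :=
    hasFDerivAt_prodMk_left z.1 z.2
  have h2 : HasFDerivAt φ (fderiv ℝ φ z) (z.1, z.2) := h.hasFDerivAt
  have h3 := (h2.comp z.1 h1).fderiv
  change fderiv ℝ (φ ∘ fun y : Sp N => (y, z.2)) z.1 _ = _
  rw [h3]
  rfl

theorem timeDeriv_eq {N : ℕ} {φ : Sp N × ℝ → ℝ} {z : Sp N × ℝ} (h : DifferentiableAt ℝ φ z) :
    timeDeriv φ z = fderiv ℝ φ z (0, 1) := by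
  have h1 : HasDerivAt (fun s : ℝ => (z.1, s)) ((0 : Sp N), (1 : ℝ)) z.2 :=
    (hasDerivAt_const z.2 z.1).prodMk (hasDerivAt_id z.2)
  have h2 : HasFDerivAt φ (fderiv ℝ φ z) (z.1, z.2) := h.hasFDerivAt
  exact (h2.comp_hasDerivAt z.2 h1).deriv

/-- Extension by zero turns local integrability data into the global data required by
`entropy_identity_weak`; the equations are only tested inside `W`. -/
theorem locallyIntegrable_and_integrable_rpow_indicator {X : Type*} [TopologicalSpace X]
    [MeasurableSpace X] {μ : Measure X} [IsLocallyFiniteMeasure μ] {W : Set X}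
    (hW : MeasurableSet W) {f : X → ℝ} {p : ℝ} (hp : 1 ≤ p)
    (hf : MemLp f (ENNReal.ofReal p) (μ.restrict W)) :
    LocallyIntegrable (W.indicator f) μ ∧ Integrable (fun z => |W.indicator f z| ^ p) μ := by
  have h1 : MemLp (W.indicator f) (ENNReal.ofReal p) μ := (memLp_indicator_iff_restrict hW).2 hf
  refine ⟨h1.locallyIntegrable (ENNReal.one_le_ofReal.2 hp), ?_⟩
  have := h1.integrable_norm_rpow (by simpa using by linarith) ENNReal.ofReal_ne_top
  rwa [ENNReal.toReal_ofReal (by linarith)] at this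

/-- A compact subset of a bounded open interval is contained in a smaller open interval. -/
theorem exists_Ioo_of_isCompact {C : Set ℝ} {T : ℝ} (hT : 0 < T) (hC : IsCompact C)
    (h : C ⊆ Ioo 0 T) : ∃ t₁ t₂, 0 < t₁ ∧ t₁ < t₂ ∧ t₂ < T ∧ C ⊆ Ioo t₁ t₂ := by
  rcases C.eq_empty_or_nonempty with rfl | hne
  · exact ⟨T / 3, T / 2, by linarith, by linarith, by linarith, empty_subset _⟩
  · obtain ⟨a, ha, ha'⟩ := hC.exists_isLeast hne
    obtain ⟨b, hb, hb'⟩ := hC.exists_isGreatest hne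
    have h1 := h ha
    have h2 := h hb
    have h3 := ha' hb
    rw [mem_Ioo] at h1 h2
    refine ⟨a / 2, (b + T) / 2, by linarith, by linarith, by linarith, fun t ht => ?_⟩
    have h4 := ha' ht
    have h5 := hb' ht
    exact ⟨by linarith, by linarith⟩

/-- Continuity bounds the norm near each time, and compactness of the time interval makes the bound
uniform. -/
theorem ContinuousInL2Loc.exists_eLpNorm_le {N : ℕ} {a b : ℝ} {u : Sp N × ℝ → ℝ}
    (hu : ContinuousInL2Loc (Icc a b) u) {K : Set (Sp N)} (hK : IsCompact K) :
    ∃ C : ℝ≥0∞, C ≠ ⊤ ∧ ∀ t ∈ Icc a b, eLpNorm (fun x => u (x, t)) 2 (volume.restrict K) ≤ C := by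
  obtain ⟨h1, h2⟩ := hu K hK
  refine (isCompact_Icc (a := a) (b := b)).induction_on
    (p := fun s => ∃ C : ℝ≥0∞, C ≠ ⊤ ∧
      ∀ t ∈ s ∩ Icc a b, eLpNorm (fun x => u (x, t)) 2 (volume.restrict K) ≤ C) ?_ ?_ ?_ ?_
      |>.imp fun C hC => ⟨hC.1, fun t ht => hC.2 t ⟨ht, ht⟩⟩
  · exact ⟨0, by simp, by simp⟩
  · rintro s t hst ⟨C, hC, h⟩
    exact ⟨C, hC, fun r hr => h r ⟨hst hr.1, hr.2⟩⟩
  · rintro s t ⟨C, hC, h⟩ ⟨D, hD, h'⟩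
    refine ⟨max C D, (max_lt hC.lt_top hD.lt_top).ne, ?_⟩
    rintro r ⟨hr | hr, hr'⟩
    · exact (h r ⟨hr, hr'⟩).trans (le_max_left _ _)
    · exact (h' r ⟨hr, hr'⟩).trans (le_max_right _ _)
  · intro t₀ ht₀
    have h3 := (h2 t₀ ht₀).eventually (gt_mem_nhds zero_lt_one)
    refine ⟨_, inter_mem h3 self_mem_nhdsWithin, 1 + eLpNorm (fun x => u (x, t₀)) 2
      (volume.restrict K), ENNReal.add_ne_top.2 ⟨by simp, (h1 t₀ ht₀).2.ne⟩, ?_⟩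
    rintro t ⟨⟨ht, -⟩, ht'⟩
    have h4 : (fun x => u (x, t)) = (fun x => u (x, t) - u (x, t₀)) + fun x => u (x, t₀) := by
      ext x; simp
    rw [h4]
    refine (eLpNorm_add_le ((h1 t ht').1.sub (h1 t₀ ht₀).1) (h1 t₀ ht₀).1 (by norm_num)).trans ?_
    gcongr
    exact le_of_lt ht

/-- A function in `C⁰([a, b]; L²_loc)` which is measurable in space-time is locally square
integrable in space-time. -/
theorem ContinuousInL2Loc.memLp_two {N : ℕ} {a b : ℝ} {u : Sp N × ℝ → ℝ}
    (hu : ContinuousInL2Loc (Icc a b) u) {K : Set (Sp N)} (hK : IsCompact K)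
    (hm : AEStronglyMeasurable u (volume.restrict (K ×ˢ Ioo a b))) :
    MemLp u 2 (volume.restrict (K ×ˢ Ioo a b)) := by
  obtain ⟨C, hC, hC'⟩ := hu.exists_eLpNorm_le hK
  refine ⟨hm, ?_⟩
  rw [eLpNorm_lt_top_iff_lintegral_rpow_enorm_lt_top (by norm_num) (by norm_num)]
  rw [Measure.volume_eq_prod, ← Measure.prod_restrict] at hm ⊢
  rw [lintegral_prod_symm _ (hm.enorm.pow_const _)]
  calc ∫⁻ t in Ioo a b, ∫⁻ x in K, ‖u (x, t)‖ₑ ^ (2 : ℝ≥0∞).toReal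
      ≤ ∫⁻ _ in Ioo a b, C ^ (2 : ℝ) := by
        refine lintegral_mono_ae ?_
        filter_upwards [ae_restrict_mem measurableSet_Ioo] with t ht
        have h1 := hC' t (Ioo_subset_Icc_self ht)
        rw [eLpNorm_eq_lintegral_rpow_enorm_toReal (by norm_num) (by norm_num)] at h1
        have h2 := ENNReal.rpow_le_rpow h1 (z := 2) (by norm_num)
        rw [← ENNReal.rpow_mul] at h2
        simpa using h2
    _ < ⊤ := by
        rw [lintegral_const]
        refine ENNReal.mul_lt_top (ENNReal.rpow_lt_top_of_nonneg (by norm_num) hC) ?_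
        simp

theorem aestronglyMeasurable_field {N : ℕ} {p : Fin N → ℝ} {T : EReal} {Λ : ℝ}
    {A : Sp N × ℝ → ℝ → Sp N → Sp N} (hA : IsAdmissibleField p T Λ A)
    {μ : Measure (Sp N × ℝ)} {u : Sp N × ℝ → ℝ} {G : Sp N × ℝ → Sp N}
    (hu : AEStronglyMeasurable u μ) (hG : ∀ i, AEStronglyMeasurable (fun z => G z i) μ)
    (i : Fin N) : AEStronglyMeasurable (fun z => A z (u z) (G z) i) μ := by
  have h1 : AEMeasurable (fun z => (fun i => G z i : Fin N → ℝ)) μ :=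
    aemeasurable_pi_iff.2 fun i => (hG i).aemeasurable
  have h2 : AEMeasurable G μ :=
    ((MeasurableEquiv.toLp 2 (Fin N → ℝ)).measurable.comp_aemeasurable h1)
  have h3 : AEMeasurable (fun z => A z (u z) (G z)) μ :=
    hA.measurable.comp_aemeasurable (aemeasurable_id.prodMk (hu.aemeasurable.prodMk h2))
  have h4 : Measurable fun y : Sp N => y i := by fun_prop
  exact (h4.comp_aemeasurable h3).aestronglyMeasurable

/-- The flux of a function in the energy space belongs to the dual Lebesgue spaces. -/
theorem memLp_field {N : ℕ} {p : Fin N → ℝ} (hp : ∀ i, 1 < p i) {T : EReal} {Λ : ℝ}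
    {A : Sp N × ℝ → ℝ → Sp N → Sp N} (hA : IsAdmissibleField p T Λ A)
    {W : Set (Sp N × ℝ)} (hW : W ⊆ strip N T) {u : Sp N × ℝ → ℝ} {G : Sp N × ℝ → Sp N}
    (hu : AEStronglyMeasurable u (volume.restrict W))
    (hG : ∀ i, MemLp (fun z => G z i) (ENNReal.ofReal (p i)) (volume.restrict W)) (i : Fin N) :
    MemLp (fun z => A z (u z) (G z) i) (ENNReal.ofReal ((p i).conjExponent))
      (volume.restrict W) := by
  have hc := Real.HolderConjugate.conjExponent (hp i)
  have hp0 : 0 < p i := hc.pos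
  have hq0 : 0 < (p i).conjExponent := hc.symm.pos
  have hm := aestronglyMeasurable_field hA hu (fun i => (hG i).1) i
  have hgr := ae_mono (Measure.restrict_mono hW le_rfl) hA.growth
  have h1 : MemLp (fun z => |G z i| ^ (p i - 1)) (ENNReal.ofReal ((p i).conjExponent))
      (volume.restrict W) := by
    have h2 := (hG i).norm_rpow_div (ENNReal.ofReal (p i - 1))
    have h3 : ENNReal.ofReal (p i) / ENNReal.ofReal (p i - 1) =
        ENNReal.ofReal ((p i).conjExponent) := by
      rw [← ENNReal.ofReal_div_of_pos (by linarith [hp i])]; rfl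
    rw [h3, ENNReal.toReal_ofReal (by linarith [hp i])] at h2
    exact h2
  refine (h1.const_mul Λ).mono hm ?_
  filter_upwards [hgr] with z hz
  refine ((hz (u z) (G z) i).2).trans ?_
  exact le_abs_self _

/-- The entropy identity for weak solutions of the parabolic equation. -/
theorem entropy_identity {N : ℕ} {p : Fin N → ℝ} (hp : ∀ i, 1 < p i) {T : ℝ} (hT : 0 < T)
    {Λ : ℝ} {A : Sp N × ℝ → ℝ → Sp N → Sp N} (hA : IsAdmissibleField p T Λ A)
    {u : Sp N × ℝ → ℝ} {G : Sp N × ℝ → Sp N} (hsol : IsLocalWeakSolution p A T u G)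
    (hen : MemEnergyOn p (Ioo 0 T) u G) (hcont : ContinuousInL2Loc (Icc 0 T) u)
    (hup : ∀ i, MemLp u (ENNReal.ofReal (p i)) (volume.restrict (strip N T)))
    {J σ τ j : ℝ → ℝ} {B : ℝ} (hE : IsEntropy J σ τ j B) {χ : Sp N × ℝ → ℝ}
    (hχ : ContDiff ℝ 1 χ) (hχc : HasCompactSupport χ) (hχs : tsupport χ ⊆ strip N T) :
    (Integrable fun z => J (u z) * timeDeriv χ z) ∧
    (∀ i, Integrable fun z =>
      A z (u z) (G z) i * u z * (σ (u z) * spaceDeriv i χ z)) ∧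
    (∀ i, Integrable fun z => A z (u z) (G z) i * G z i * (τ (u z) * χ z)) ∧
    ∫ z, J (u z) * timeDeriv χ z =
      ∑ i, ((∫ z, A z (u z) (G z) i * u z * (σ (u z) * spaceDeriv i χ z)) +
        ∫ z, A z (u z) (G z) i * G z i * (τ (u z) * χ z)) := by
  obtain ⟨R, hR⟩ := (hχc.isCompact.image continuous_fst).isBounded.subset_ball (0 : Sp N)
  set K : Set (Sp N) := Metric.closedBall 0 R with hKdef
  have hK : IsCompact K := isCompact_closedBall _ _
  set W : Set (Sp N × ℝ) := K ×ˢ Ioo 0 T with hWdef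
  have hWm : MeasurableSet W := hK.measurableSet.prod measurableSet_Ioo
  have hWs : W ⊆ strip N T := by
    rw [strip_coe]; exact prod_mono (subset_univ _) le_rfl
  set O : Set (Sp N × ℝ) := Metric.ball 0 R ×ˢ Ioo 0 T with hOdef
  have hO : IsOpen O := Metric.isOpen_ball.prod isOpen_Ioo
  have hOW : O ⊆ W := prod_mono Metric.ball_subset_closedBall le_rfl
  have hχO : tsupport χ ⊆ O := fun z hz =>
    ⟨hR ⟨z, hz, rfl⟩, by have := hχs hz; rw [strip_coe] at this; exact this.2⟩
  have hum : AEStronglyMeasurable u (volume.restrict W) := (hen.1 K hK).1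
  have hu1 := locallyIntegrable_and_integrable_rpow_indicator hWm le_rfl (hen.1 K hK)
  have hu2 := locallyIntegrable_and_integrable_rpow_indicator (p := 2) hWm (by norm_num)
    -- Square integrability comes from continuity in time with values in `L²_loc`, because no `p_i ≥
    -- 2` is assumed.
    (by simpa using hcont.memLp_two hK hum)
  have hup' := fun i => locallyIntegrable_and_integrable_rpow_indicator hWm (hp i).le
    ((hup i).mono_measure (Measure.restrict_mono hWs le_rfl))
  have hG := fun i => locallyIntegrable_and_integrable_rpow_indicator hWm (hp i).le
    (hen.2 i K hK)
  have hc := fun i => Real.HolderConjugate.conjExponent (hp i)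
  have ha := fun i => locallyIntegrable_and_integrable_rpow_indicator hWm (hc i).symm.lt.le
    (memLp_field hp hA hWs hum (fun i => hen.2 i K hK) i)
  have hsupp : ∀ {ψ : Sp N × ℝ → ℝ}, tsupport ψ ⊆ O → ∀ z ∉ W, ψ z = 0 ∧ fderiv ℝ ψ z = 0 := by
    intro ψ hψ z hz
    have hz' : z ∉ tsupport ψ := fun h => hz (hOW (hψ h))
    exact ⟨image_eq_zero_of_notMem_tsupport hz', fderiv_of_notMem_tsupport ℝ hz'⟩
  have hgrad : ∀ i, ∀ ψ : Sp N × ℝ → ℝ, ContDiff ℝ ∞ ψ → HasCompactSupport ψ →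
      tsupport ψ ⊆ O →
      ∫ z, W.indicator u z * fderiv ℝ ψ z (EuclideanSpace.single i 1, 0) =
        - ∫ z, W.indicator (fun z => G z i) z * ψ z := by
    intro i ψ hψ hψc hψO
    have hψs : tsupport ψ ⊆ strip N T := hψO.trans (hOW.trans hWs)
    have h1 := hsol.gradient i ψ hψ hψc hψs
    have hd := hψ.differentiable (by simp)
    rw [setIntegral_eq_integral_of_forall_compl_eq_zero,
      setIntegral_eq_integral_of_forall_compl_eq_zero] at h1
    · convert h1 using 2
      · ext z
        rw [spaceDeriv_eq i (hd z)]
        by_cases hz : z ∈ W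
        · rw [indicator_of_mem hz]
        · simp [(hsupp hψO z hz).2]
      · congr 1
        ext z
        by_cases hz : z ∈ W
        · rw [indicator_of_mem hz]
        · simp [(hsupp hψO z hz).1]
    · intro z hz
      simp [(hsupp hψO z fun h => hz (hWs h)).1]
    · intro z hz
      rw [spaceDeriv_eq i (hd z)]
      simp [(hsupp hψO z fun h => hz (hWs h)).2]
  have hbal : ∀ ψ : Sp N × ℝ → ℝ, ContDiff ℝ ∞ ψ → HasCompactSupport ψ → tsupport ψ ⊆ O →
      ∫ z, W.indicator u z * fderiv ℝ ψ z (0, 1) =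
        ∑ i, ∫ z, W.indicator (fun z => A z (u z) (G z) i) z *
          fderiv ℝ ψ z (EuclideanSpace.single i 1, 0) := by
    intro ψ hψ hψc hψO
    have hd := hψ.differentiable (by simp)
    -- The open slab contains the support of `ψ`, so both boundary terms of the weak formulation
    -- vanish.
    obtain ⟨t₁, t₂, h0, h12, h2, hts⟩ := exists_Ioo_of_isCompact hT
      (hψc.isCompact.image continuous_snd)
      (by rintro _ ⟨z, hz, rfl⟩; exact (hψO hz).2)
    have hoff : ∀ x, ∀ t ∉ Ioo t₁ t₂, (x, t) ∉ tsupport ψ := fun x t ht h => ht (hts ⟨_, h, rfl⟩)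
    have h1 := hsol.equation t₁ t₂ h0 h12 h2 ψ ⟨hψ.contDiffOn, fun a b _ _ =>
      ⟨Prod.fst '' tsupport ψ, hψc.isCompact.image continuous_fst, fun t _ x hx =>
        image_eq_zero_of_notMem_tsupport fun h => hx ⟨_, h, rfl⟩⟩⟩
    have e1 : ∀ x, ψ (x, t₁) = 0 := fun x =>
      image_eq_zero_of_notMem_tsupport (hoff x t₁ (by simp))
    have e2 : ∀ x, ψ (x, t₂) = 0 := fun x =>
      image_eq_zero_of_notMem_tsupport (hoff x t₂ (by simp))
    simp only [e1, e2, mul_zero, integral_zero, sub_zero, zero_add] at h1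
    rw [setIntegral_eq_integral_of_forall_compl_eq_zero] at h1
    · have hcont : ∀ v, Continuous fun z => fderiv ℝ ψ z v := fun v =>
        (hψ.continuous_fderiv (by simp)).clm_apply continuous_const
      have i0 : Integrable fun z => W.indicator u z * fderiv ℝ ψ z (0, 1) := by
        simpa [mul_comm] using hu1.1.integrable_smul_left_of_hasCompactSupport (hcont (0, 1))
          (hψc.fderiv_apply ℝ _)
      have ii : ∀ i, Integrable fun z => W.indicator (fun z => A z (u z) (G z) i) z *
          fderiv ℝ ψ z (EuclideanSpace.single i 1, 0) := fun i => by
        simpa [mul_comm] using (ha i).1.integrable_smul_left_of_hasCompactSupport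
          (hcont (EuclideanSpace.single i 1, 0)) (hψc.fderiv_apply ℝ _)
      rw [← integral_finsetSum _ fun i _ => ii i, ← sub_eq_zero, ← neg_eq_zero, neg_sub,
        ← integral_sub (integrable_finsetSum _ fun i _ => ii i) i0]
      refine Eq.trans ?_ h1
      refine integral_congr_ae (Eventually.of_forall fun z => ?_)
      simp only [timeDeriv_eq (hd z), spaceDeriv_eq _ (hd z)]
      by_cases hz : z ∈ W
      · simp only [indicator_of_mem hz]; ring
      · simp [(hsupp hψO z hz).2]
    · rintro ⟨x, t⟩ hz
      have hz' : (x, t) ∉ tsupport ψ := hoff x t fun h => hz ⟨mem_univ _, h⟩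
      simp [timeDeriv_eq (hd _), spaceDeriv_eq _ (hd _), fderiv_of_notMem_tsupport ℝ hz']
  have key := entropy_identity_weak hE hO (fun i => (hc i).symm) hu1.1 (fun i => (hG i).1)
    (fun i => (ha i).1) hu2.2 (fun i => (hup' i).2) (fun i => (hG i).2) (fun i => (ha i).2)
    hgrad hbal hχ hχc hχO
  have hd := hχ.differentiable one_ne_zero
  have c1 : (fun z => W.indicator u z * W.indicator u z *
      (j (W.indicator u z) * fderiv ℝ χ z (0, 1))) = fun z => J (u z) * timeDeriv χ z := by
    ext z
    rw [timeDeriv_eq (hd z), hE.eq_mul]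
    by_cases hz : z ∈ W
    · simp only [indicator_of_mem hz]; ring
    · simp [(hsupp hχO z hz).2]
  have c2 : ∀ i, (fun z => W.indicator (fun z => A z (u z) (G z) i) z * W.indicator u z *
      (σ (W.indicator u z) * fderiv ℝ χ z (EuclideanSpace.single i 1, 0))) =
      fun z => A z (u z) (G z) i * u z * (σ (u z) * spaceDeriv i χ z) := fun i => by
    ext z
    rw [spaceDeriv_eq i (hd z)]
    by_cases hz : z ∈ W
    · simp only [indicator_of_mem hz]
    · simp [(hsupp hχO z hz).2]
  have c3 : ∀ i, (fun z => W.indicator (fun z => A z (u z) (G z) i) z *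
      W.indicator (fun z => G z i) z * (τ (W.indicator u z) * χ z)) =
      fun z => A z (u z) (G z) i * G z i * (τ (u z) * χ z) := fun i => by
    ext z
    by_cases hz : z ∈ W
    · simp only [indicator_of_mem hz]
    · simp [(hsupp hχO z hz).1]
  simp only [c1, c2, c3] at key
  exact key

/-! ### The localized entropy inequality -/

/-- If `y ≤ κ g z`, the first term on the right suffices. Otherwise `g z ≤ y / κ`, and `z ^ (m - 1)
≤ z ^ (p - 1)` because `z ≤ 1` and `p ≤ m`, so the second term does. Applied with `g = |D_i u|` and
`z = ζ`, it absorbs the flux through the cutoff. -/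
theorem rpow_mul_pow_mul_le_young {p κ g z y : ℝ} {m : ℕ} (hp : 1 < p) (hm : p ≤ m) (hκ : 0 < κ)
    (hg : 0 ≤ g) (hz : 0 ≤ z) (hz1 : z ≤ 1) (hy : 0 ≤ y) :
    g ^ (p - 1) * z ^ (m - 1) * y ≤ κ * (g ^ p * z ^ m) + κ ^ (1 - p) * y ^ p := by
  have hm1 : 1 ≤ m := by
    have : (1 : ℝ) < m := hp.trans_le hm
    exact_mod_cast this.le
  have hgp : g ^ p = g ^ (p - 1) * g := by
    rw [← Real.rpow_add_one' hg (by linarith)]; simp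
  have hyp : y ^ p = y ^ (p - 1) * y := by
    rw [← Real.rpow_add_one' hy (by linarith)]; simp
  have hzm : z ^ m = z ^ (m - 1) * z := by
    rw [← pow_succ, Nat.sub_add_cancel hm1]
  have t1 : 0 ≤ κ * (g ^ p * z ^ m) := by positivity
  have t2 : 0 ≤ κ ^ (1 - p) * y ^ p := by positivity
  rcases le_total y (κ * (g * z)) with h | h
  · have : g ^ (p - 1) * z ^ (m - 1) * y ≤ g ^ (p - 1) * z ^ (m - 1) * (κ * (g * z)) := by gcongr
    refine this.trans (le_trans (le_of_eq ?_) (le_add_of_nonneg_right t2))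
    rw [hgp, hzm]; ring
  · have h1 : z ^ (m - 1) ≤ z ^ (p - 1) := by
      rcases hz.eq_or_lt with rfl | hz0
      · rw [zero_pow (by
          have : (1 : ℝ) < m := hp.trans_le hm
          have : 1 < m := by exact_mod_cast this
          omega)]
        positivity
      · rw [← Real.rpow_natCast]
        refine Real.rpow_le_rpow_of_exponent_ge hz0 hz1 ?_
        push_cast [hm1]
        linarith
    have h2 : g * z ≤ κ⁻¹ * y := by
      rw [inv_mul_eq_div, le_div_iff₀ hκ]; linarith
    calc g ^ (p - 1) * z ^ (m - 1) * y ≤ g ^ (p - 1) * z ^ (p - 1) * y := by gcongr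
      _ = (g * z) ^ (p - 1) * y := by rw [Real.mul_rpow hg hz]
      _ ≤ (κ⁻¹ * y) ^ (p - 1) * y := by
          have : 0 ≤ p - 1 := by linarith
          gcongr
      _ = κ ^ (1 - p) * y ^ p := by
          rw [Real.mul_rpow (by positivity) hy, hyp, Real.inv_rpow hκ.le, ← Real.rpow_neg hκ.le,
            neg_sub]
          ring
      _ ≤ _ := le_add_of_nonneg_left t1

/-- A space-time cutoff `ζ(x) ^ m * θ(t)`. -/
noncomputable def cutoff {N : ℕ} (ζ : Sp N → ℝ) (m : ℕ) (θ : ℝ → ℝ) (z : Sp N × ℝ) : ℝ :=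
  ζ z.1 ^ m * θ z.2

theorem spaceDeriv_cutoff {N : ℕ} {ζ : Sp N → ℝ} (hζ : Differentiable ℝ ζ) (m : ℕ) (θ : ℝ → ℝ)
    (i : Fin N) (z : Sp N × ℝ) : spaceDeriv i (cutoff ζ m θ) z =
      m * ζ z.1 ^ (m - 1) * fderiv ℝ ζ z.1 (EuclideanSpace.single i 1) * θ z.2 := by
  have h := (((hζ z.1).hasFDerivAt.pow m).mul_const (θ z.2)).fderiv
  change fderiv ℝ (fun y => ζ y ^ m * θ z.2) z.1 _ = _
  rw [h]
  simp
  ring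

theorem timeDeriv_cutoff {N : ℕ} (ζ : Sp N → ℝ) (m : ℕ) {θ : ℝ → ℝ} (hθ : Differentiable ℝ θ)
    (z : Sp N × ℝ) : timeDeriv (cutoff ζ m θ) z = ζ z.1 ^ m * deriv θ z.2 :=
  ((hθ z.2).hasDerivAt.const_mul (ζ z.1 ^ m)).deriv

theorem tsupport_cutoff_subset {N : ℕ} (ζ : Sp N → ℝ) {m : ℕ} (hm : m ≠ 0) (θ : ℝ → ℝ) :
    tsupport (cutoff ζ m θ) ⊆ tsupport ζ ×ˢ tsupport θ := by
  refine closure_minimal ?_ ((isClosed_tsupport ζ).prod (isClosed_tsupport θ))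
  intro z hz
  have hz' : ζ z.1 ^ m * θ z.2 ≠ 0 := hz
  refine ⟨subset_tsupport _ fun h => hz' ?_, subset_tsupport _ fun h => hz' ?_⟩
  · rw [h, zero_pow hm, zero_mul]
  · rw [h, mul_zero]

/-- Localized entropy inequality. -/
theorem entropy_inequality {N : ℕ} {p : Fin N → ℝ} (hp : ∀ i, 1 < p i) {T : ℝ} (hT : 0 < T)
    {Λ : ℝ} (hΛ : 0 < Λ) {A : Sp N × ℝ → ℝ → Sp N → Sp N} (hA : IsAdmissibleField p T Λ A)
    {u : Sp N × ℝ → ℝ} {G : Sp N × ℝ → Sp N} (hsol : IsLocalWeakSolution p A T u G)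
    (hen : MemEnergyOn p (Ioo 0 T) u G) (hcont : ContinuousInL2Loc (Icc 0 T) u)
    (hup : ∀ i, MemLp u (ENNReal.ofReal (p i)) (volume.restrict (strip N T)))
    {J σ τ j : ℝ → ℝ} {B ε : ℝ} (hE : IsEntropy J σ τ j B) (hε : 0 < ε) (hτ : ∀ s, ε ≤ τ s)
    {m : ℕ} (hm : m ≠ 0) (hpm : ∀ i, p i ≤ m) {ζ : Sp N → ℝ} (hζ : ContDiff ℝ 1 ζ)
    (hζc : HasCompactSupport ζ) (hζ0 : ∀ x, 0 ≤ ζ x) (hζ1 : ∀ x, ζ x ≤ 1) {D : ℝ}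
    (hD : ∀ x i, |fderiv ℝ ζ x (EuclideanSpace.single i 1)| ≤ D)
    {θ : ℝ → ℝ} (hθ : ContDiff ℝ 1 θ) (hθc : HasCompactSupport θ) (hθs : tsupport θ ⊆ Ioo 0 T)
    (hθ0 : ∀ t, 0 ≤ θ t) (hθ1 : ∀ t, θ t ≤ 1) :
    - ∑ i, (ε * Λ⁻¹) ^ (1 - p i) * (∫ z in strip N T, (Λ * B * m * |D| * |u z|) ^ p i) ≤
      ∫ t, (∫ x, J (u (x, t)) * ζ x ^ m) * deriv θ t := by
  have hζd := hζ.differentiable one_ne_zero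
  have hθd := hθ.differentiable one_ne_zero
  have hχ : ContDiff ℝ 1 (cutoff ζ m θ) :=
    ((hζ.comp contDiff_fst).pow m).mul (hθ.comp contDiff_snd)
  have hχs := tsupport_cutoff_subset ζ hm θ
  have hχc : HasCompactSupport (cutoff ζ m θ) :=
    (hζc.isCompact.prod hθc.isCompact).of_isClosed_subset (isClosed_tsupport _) hχs
  have hstrip : tsupport (cutoff ζ m θ) ⊆ strip N T := by
    rw [strip_coe]
    exact hχs.trans (prod_mono (subset_univ _) hθs)
  have hSm : MeasurableSet (strip N T) := by
    rw [strip_coe]; exact MeasurableSet.univ.prod measurableSet_Ioo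
  obtain ⟨h1, h2, h3, h4⟩ :=
    entropy_identity hp hT hA hsol hen hcont hup hE hχ hχc hstrip
  have hB := hE.nonneg_bound
  have h5 : ∫ z, J (u z) * timeDeriv (cutoff ζ m θ) z =
      ∫ t, (∫ x, J (u (x, t)) * ζ x ^ m) * deriv θ t := by
    rw [Measure.volume_eq_prod] at h1 ⊢
    rw [integral_prod_symm _ h1]
    refine integral_congr_ae (Eventually.of_forall fun t => ?_)
    simp only [timeDeriv_cutoff ζ m hθd, ← mul_assoc]
    rw [integral_mul_const]
  rw [← h5, h4, ← Finset.sum_neg_distrib]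
  refine Finset.sum_le_sum fun i _ => ?_
  rw [← integral_add (h2 i) (h3 i), ← integral_const_mul, ← integral_neg,
    ← integral_indicator hSm]
  have hui : Integrable (fun z => (Λ * B * m * |D| * |u z|) ^ p i)
      (volume.restrict (strip N T)) := by
    have h6 := (hup i).integrable_norm_rpow (by simpa using by linarith [hp i])
      ENNReal.ofReal_ne_top
    rw [ENNReal.toReal_ofReal (by linarith [hp i])] at h6
    refine (h6.const_mul ((Λ * B * m * |D|) ^ p i)).congr (Eventually.of_forall fun z => ?_)
    exact (Real.mul_rpow (by positivity) (abs_nonneg _)).symm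
  refine integral_mono_ae ((integrable_indicator_iff hSm).2 (hui.const_mul _).neg)
    ((h2 i).add (h3 i)) ?_
  have hgr := (ae_restrict_iff' hSm).1 hA.growth
  filter_upwards [hgr] with z hz
  by_cases hzs : z ∈ strip N T
  · obtain ⟨g1, g2⟩ := hz hzs (u z) (G z) i
    rw [indicator_of_mem hzs]
    simp only [spaceDeriv_cutoff hζd, cutoff]
    set a := A z (u z) (G z) i
    set g := |G z i|
    set ξ := ζ z.1 with hξ
    have k0 : 0 ≤ ξ := hζ0 _
    have k1 : ξ ≤ 1 := hζ1 _
    have n0 := hθ0 z.2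
    have n1 := hθ1 z.2
    set d := fderiv ℝ ζ z.1 (EuclideanSpace.single i 1)
    have hd : |d| ≤ |D| := (hD _ _).trans (le_abs_self _)
    have hg : 0 ≤ g := abs_nonneg _
    have hσ := hE.abs_σ_le (u z)
    -- Here `κ = ε Λ⁻¹` is exactly the coefficient of the coercive lower bound `e2`, so the gradient
    -- terms cancel against it.
    have hy := rpow_mul_pow_mul_le_young (κ := ε * Λ⁻¹) (y := Λ * B * m * |D| * |u z|)
      (hp i) (hpm i) (by positivity) hg k0 k1 (by positivity)
    -- Cutoff term: growth of `A` and `|J'(u)| ≤ B |u|`.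
    have e1 : -(g ^ (p i - 1) * ξ ^ (m - 1) * (Λ * B * m * |D| * |u z|)) * θ z.2 ≤
        a * u z * (σ (u z) * (m * ξ ^ (m - 1) * d * θ z.2)) := by
      have : |a * u z * (σ (u z) * (m * ξ ^ (m - 1) * d))| ≤
          g ^ (p i - 1) * ξ ^ (m - 1) * (Λ * B * m * |D| * |u z|) := by
        have hmξ : |(m : ℝ) * ξ ^ (m - 1)| = m * ξ ^ (m - 1) := abs_of_nonneg (by positivity)
        rw [abs_mul, abs_mul, abs_mul, abs_mul, hmξ]
        calc |a| * |u z| * (|σ (u z)| * (m * ξ ^ (m - 1) * |d|))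
            ≤ (Λ * g ^ (p i - 1)) * |u z| * (B * (m * ξ ^ (m - 1) * |D|)) := by gcongr
          _ = _ := by ring
      have h7 := mul_le_mul_of_nonneg_right (neg_le_of_abs_le this) n0
      linarith
    -- Gradient term: coercivity of `A` and `J'' ≥ ε`.
    have e2 : ε * Λ⁻¹ * (g ^ p i * ξ ^ m) * θ z.2 ≤
        a * G z i * (τ (u z) * (ξ ^ m * θ z.2)) := by
      have h8 : 0 ≤ Λ⁻¹ * g ^ p i := by positivity
      calc ε * Λ⁻¹ * (g ^ p i * ξ ^ m) * θ z.2
          = (Λ⁻¹ * g ^ p i) * (ε * (ξ ^ m * θ z.2)) := by ring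
        _ ≤ (Λ⁻¹ * g ^ p i) * (τ (u z) * (ξ ^ m * θ z.2)) := by
            have := hτ (u z)
            gcongr
        _ ≤ _ := by
            have := hε.le.trans (hτ (u z))
            gcongr
    have e3 : 0 ≤ (ε * Λ⁻¹) ^ (1 - p i) * (Λ * B * m * |D| * |u z|) ^ p i := by positivity
    have e4 := mul_le_mul_of_nonneg_right hy n0
    have e5 := mul_le_of_le_one_right e3 n1
    linarith
  · have hz1 : cutoff ζ m θ z = 0 :=
      image_eq_zero_of_notMem_tsupport fun h => hzs (hstrip h)
    have hz2 : spaceDeriv i (cutoff ζ m θ) z = 0 := by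
      rw [spaceDeriv_eq i (hχ.differentiable one_ne_zero z),
        fderiv_of_notMem_tsupport ℝ fun h => hzs (hstrip h)]
      rfl
    rw [indicator_of_notMem hzs, hz1, hz2]
    simp

/-! ### From weak to pointwise monotonicity in time -/

/-- Averages against the derivative of a steep smooth step approximate point values. -/
theorem abs_integral_mul_deriv_step_sub_le {f : ℝ → ℝ} {c h κ : ℝ} (hh : 0 < h)
    (hf : ContinuousOn f (Icc c (c + h))) (hκ : ∀ t ∈ Icc c (c + h), |f t - f c| ≤ κ) :
    Integrable (fun t => f t * deriv (fun t => Real.smoothTransition ((t - c) / h)) t) ∧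
    |(∫ t, f t * deriv (fun t => Real.smoothTransition ((t - c) / h)) t) - f c| ≤ κ := by
  set s : ℝ → ℝ := fun t => Real.smoothTransition ((t - c) / h) with hs
  have hsd : ContDiff ℝ 1 s :=
    Real.smoothTransition.contDiff.comp ((contDiff_id.sub contDiff_const).div_const h)
  have hsc : Continuous (deriv s) := hsd.continuous_deriv le_rfl
  have hmono : Monotone s := fun a b hab =>
    Real.smoothTransition.monotone (by gcongr)
  have hpos : ∀ t, 0 ≤ deriv s t := fun t => hmono.deriv_nonneg
  have hzero : ∀ t ∉ Icc c (c + h), deriv s t = 0 := by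
    intro t ht
    rw [mem_Icc, not_and_or, not_le, not_le] at ht
    rcases ht with ht | ht
    · have : s =ᶠ[𝓝 t] fun _ => 0 := by
        filter_upwards [gt_mem_nhds ht] with r hr
        exact Real.smoothTransition.zero_of_nonpos
          (div_nonpos_of_nonpos_of_nonneg (by linarith) hh.le)
      rw [this.deriv_eq, deriv_const]
    · have : s =ᶠ[𝓝 t] fun _ => 1 := by
        filter_upwards [lt_mem_nhds ht] with r hr
        exact Real.smoothTransition.one_of_one_le ((one_le_div hh).2 (by linarith))
      rw [this.deriv_eq, deriv_const]
  have hint : ∀ g : ℝ → ℝ, ContinuousOn g (Icc c (c + h)) → Integrable fun t => g t * deriv s t := by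
    intro g hg
    refine IntegrableOn.integrable_of_forall_notMem_eq_zero
      ((hg.mul hsc.continuousOn).integrableOn_Icc) fun t ht => ?_
    simp [hzero t ht]
  -- The derivative of the step is a probability density carried by `[c, c + h]`.
  have hone : ∫ t, deriv s t = 1 := by
    rw [← setIntegral_eq_integral_of_forall_compl_eq_zero (s := Icc c (c + h)) hzero,
      integral_Icc_eq_integral_Ioc, ← intervalIntegral.integral_of_le (by linarith),
      intervalIntegral.integral_deriv_eq_sub
        (fun t _ => hsd.differentiable one_ne_zero t) (hsc.intervalIntegrable _ _)]
    simp [hs, hh.ne']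
  refine ⟨hint f hf, ?_⟩
  have hc : f c = ∫ t, f c * deriv s t := by rw [integral_const_mul, hone, mul_one]
  have h1 : Integrable (deriv s) := by simpa using hint (fun _ => 1) continuousOn_const
  calc |(∫ t, f t * deriv s t) - f c| = |∫ t, (f t * deriv s t - f c * deriv s t)| := by
        rw [integral_sub (hint f hf) (hint _ continuousOn_const), ← hc]
    _ ≤ ∫ t, κ * deriv s t := by
        rw [← Real.norm_eq_abs]
        refine norm_integral_le_of_norm_le (h1.const_mul κ) (Eventually.of_forall fun t => ?_)
        rw [← sub_mul, Real.norm_eq_abs, abs_mul, abs_of_nonneg (hpos t)]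
        by_cases ht : t ∈ Icc c (c + h)
        · exact mul_le_mul_of_nonneg_right (hκ t ht) (hpos t)
        · simp [hzero t ht]
    _ = κ := by rw [integral_const_mul, hone, mul_one]

/-- A continuous function which is weakly almost nonincreasing is so pointwise. -/
theorem le_add_of_weak_derivative {f : ℝ → ℝ} {T η : ℝ} (hT : 0 < T)
    (hf : ContinuousOn f (Icc 0 T))
    (hw : ∀ θ : ℝ → ℝ, ContDiff ℝ 1 θ → HasCompactSupport θ → tsupport θ ⊆ Ioo 0 T →
      (∀ t, 0 ≤ θ t) → (∀ t, θ t ≤ 1) → - η ≤ ∫ t, f t * deriv θ t) :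
    ∀ t ∈ Icc 0 T, f t ≤ f 0 + η := by
  have hmain : ∀ t₁ t₂, 0 < t₁ → t₁ < t₂ → t₂ < T → f t₂ ≤ f t₁ + η := by
    intro t₁ t₂ h0 h12 h2
    refine le_of_forall_pos_le_add fun κ hκ => ?_
    have hev : ∀ c, 0 < c → c < T → ∃ δ > 0, ∀ t ∈ Icc c (c + δ), t < T ∧ |f t - f c| ≤ κ / 2 := by
      intro c hc hcT
      have hcont : ContinuousAt f c := hf.continuousAt (Icc_mem_nhds hc hcT)
      have h1 : ∀ᶠ t in 𝓝 c, t < T ∧ |f t - f c| ≤ κ / 2 := by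
        refine (gt_mem_nhds hcT).and ?_
        filter_upwards [hcont (Metric.closedBall_mem_nhds (f c) (half_pos hκ))] with t ht
        exact ht
      obtain ⟨δ, hδ, h⟩ := Metric.eventually_nhds_iff_ball.1 h1
      refine ⟨δ / 2, half_pos hδ, fun t ht => h t ?_⟩
      rw [Metric.mem_ball, Real.dist_eq, abs_of_nonneg (by linarith [ht.1])]
      linarith [ht.2]
    obtain ⟨δ₁, hδ₁, hh₁⟩ := hev t₁ h0 (h12.trans h2)
    obtain ⟨δ₂, hδ₂, hh₂⟩ := hev t₂ (h0.trans h12) h2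
    set h := min δ₁ δ₂
    have hh : 0 < h := lt_min hδ₁ hδ₂
    have s1 : Icc t₁ (t₁ + h) ⊆ Icc t₁ (t₁ + δ₁) :=
      Icc_subset_Icc le_rfl (by linarith [min_le_left δ₁ δ₂])
    have s2 : Icc t₂ (t₂ + h) ⊆ Icc t₂ (t₂ + δ₂) :=
      Icc_subset_Icc le_rfl (by linarith [min_le_right δ₁ δ₂])
    have hend : t₂ + h < T := (hh₂ (t₂ + h) (s2 ⟨by linarith, le_rfl⟩)).1
    obtain ⟨i1, b1⟩ := abs_integral_mul_deriv_step_sub_le hh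
      (hf.mono (Icc_subset_Icc (by linarith) (by linarith))) fun t ht => (hh₁ t (s1 ht)).2
    obtain ⟨i2, b2⟩ := abs_integral_mul_deriv_step_sub_le hh
      (hf.mono (Icc_subset_Icc (by linarith) (by linarith))) fun t ht => (hh₂ t (s2 ht)).2
    -- The test function `S t₁ - S t₂` is a smoothed indicator of `[t₁, t₂]`; pairing `f` with its
    -- derivative gives `f t₁ - f t₂` up to `κ / 2` from each end.
    set S : ℝ → ℝ → ℝ := fun c t => Real.smoothTransition ((t - c) / h) with hS
    have hSd : ∀ c, ContDiff ℝ 1 (S c) := fun c =>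
      Real.smoothTransition.contDiff.comp ((contDiff_id.sub contDiff_const).div_const h)
    have hts : tsupport (fun t => S t₁ t - S t₂ t) ⊆ Icc t₁ (t₂ + h) := by
      refine closure_minimal (fun t ht => ?_) isClosed_Icc
      by_contra hcon
      apply ht
      rw [mem_Icc, not_and_or, not_le, not_le] at hcon
      rcases hcon with hc | hc
      · simp only [hS]
        rw [Real.smoothTransition.zero_of_nonpos
          (div_nonpos_of_nonpos_of_nonneg (by linarith) hh.le),
          Real.smoothTransition.zero_of_nonpos
          (div_nonpos_of_nonpos_of_nonneg (by linarith) hh.le), sub_zero]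
      · simp only [hS]
        rw [Real.smoothTransition.one_of_one_le ((one_le_div hh).2 (by linarith)),
          Real.smoothTransition.one_of_one_le ((one_le_div hh).2 (by linarith)), sub_self]
    have hθ := hw (fun t => S t₁ t - S t₂ t) ((hSd t₁).sub (hSd t₂))
      (isCompact_Icc.of_isClosed_subset (isClosed_tsupport _) hts)
      (hts.trans (Icc_subset_Ioo h0 hend))
      (fun t => sub_nonneg.2 (Real.smoothTransition.monotone (by gcongr)))
      (fun t => by
        have := Real.smoothTransition.le_one ((t - t₁) / h)
        have := Real.smoothTransition.nonneg ((t - t₂) / h)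
        simp only [hS]; linarith)
    have hder : ∀ t, f t * deriv (fun t => S t₁ t - S t₂ t) t =
        f t * deriv (S t₁) t - f t * deriv (S t₂) t := fun t => by
      rw [← mul_sub, ← deriv_sub ((hSd t₁).differentiable one_ne_zero t)
        ((hSd t₂).differentiable one_ne_zero t)]
      rfl
    simp_rw [hder] at hθ
    rw [integral_sub i1 i2] at hθ
    rw [abs_le] at b1 b2
    linarith [b1.2, b2.1]
  -- Continuity lets the earlier time tend to `0`; the later one then tends to `T`.
  have hleft : ∀ t ∈ Ioo 0 T, f t ≤ f 0 + η := by
    intro t ht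
    have hcl : closure (Ioo 0 t) = Icc 0 t := closure_Ioo ht.1.ne
    refine le_on_closure (s := Ioo 0 t) (f := fun _ => f t) (g := fun r => f r + η)
      (fun r hr => hmain r t hr.1 hr.2 ht.2) continuousOn_const ?_
      (by rw [hcl]; exact ⟨le_rfl, ht.1.le⟩)
    rw [hcl]
    exact (hf.mono (Icc_subset_Icc le_rfl ht.2.le)).add continuousOn_const
  intro t ht
  have hcl : closure (Ioo 0 T) = Icc 0 T := closure_Ioo hT.ne
  exact le_on_closure (s := Ioo 0 T) (g := fun _ => f 0 + η) hleft (by rwa [hcl])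
    continuousOn_const (by rwa [hcl])

/-! ### The regularized absolute value and continuity of its integral -/

/-- A smooth, strictly convex regularization of the absolute value. -/
theorem isEntropy_sqrt {ε : ℝ} (hε : 0 < ε) :
    IsEntropy (fun s => √(ε ^ 2 + s ^ 2) - ε + ε / 2 * s ^ 2)
      (fun s => 1 / √(ε ^ 2 + s ^ 2) + ε)
      (fun s => ε ^ 2 / ((ε ^ 2 + s ^ 2) * √(ε ^ 2 + s ^ 2)) + ε)
      (fun s => 1 / (√(ε ^ 2 + s ^ 2) + ε) + ε / 2) (1 / ε + ε) := by
  have hpos : ∀ s : ℝ, 0 < ε ^ 2 + s ^ 2 := fun s => by positivity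
  have hr : ∀ s : ℝ, 0 < √(ε ^ 2 + s ^ 2) := fun s => Real.sqrt_pos.2 (hpos s)
  have hrε : ∀ s : ℝ, ε ≤ √(ε ^ 2 + s ^ 2) := fun s =>
    Real.le_sqrt_of_sq_le (by nlinarith [sq_nonneg s])
  have hsq : ∀ s : ℝ, √(ε ^ 2 + s ^ 2) ^ 2 = ε ^ 2 + s ^ 2 := fun s => Real.sq_sqrt (hpos s).le
  have hd0 : ∀ s : ℝ, HasDerivAt (fun s : ℝ => ε ^ 2 + s ^ 2) (2 * s) s := fun s => by
    simpa using (hasDerivAt_pow 2 s).const_add (ε ^ 2)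
  have hd : ∀ s : ℝ, HasDerivAt (fun s : ℝ => √(ε ^ 2 + s ^ 2)) (s / √(ε ^ 2 + s ^ 2)) s :=
    fun s => by
      convert (hd0 s).sqrt (hpos s).ne' using 1
      field_simp
  have hc : Continuous fun s : ℝ => √(ε ^ 2 + s ^ 2) := by fun_prop
  refine ⟨fun s => ?_, fun s => ?_, fun s => ?_, ?_, ?_, ?_, fun s => ?_, fun s => ?_,
    fun s => ?_⟩
  · refine (((hd s).sub_const ε).add ((hasDerivAt_pow 2 s).const_mul (ε / 2))).congr_deriv ?_
    norm_num
    ring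
  · have h1 := (hasDerivAt_id s).mul
      (((hasDerivAt_const s (1 : ℝ)).div (hd s) (hr s).ne').add_const ε)
    refine h1.congr_deriv ?_
    have h2 := (hr s).ne'
    have h3 := hsq s
    change 1 * (1 / √(ε ^ 2 + s ^ 2) + ε) + s * ((0 * √(ε ^ 2 + s ^ 2) -
      1 * (s / √(ε ^ 2 + s ^ 2))) / √(ε ^ 2 + s ^ 2) ^ 2) = _
    generalize √(ε ^ 2 + s ^ 2) = r at h2 h3 ⊢
    rw [← h3]
    field_simp
    linear_combination h3
  -- Rationalization: `√(ε² + s²) - ε = s² / (√(ε² + s²) + ε)`.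
  · have h1 : √(ε ^ 2 + s ^ 2) + ε ≠ 0 := by have := hr s; positivity
    have h3 := hsq s
    generalize √(ε ^ 2 + s ^ 2) = r at h1 h3
    field_simp
    linear_combination 2 * h3
  · exact (continuous_const.div hc fun s => (hr s).ne').add continuous_const
  · exact (continuous_const.div ((by fun_prop : Continuous fun s : ℝ => ε ^ 2 + s ^ 2).mul hc)
      fun s => (mul_pos (hpos s) (hr s)).ne').add continuous_const
  · exact (continuous_const.div (hc.add continuous_const)
      fun s => (add_pos (hr s) hε).ne').add continuous_const
  · have := hr s
    rw [abs_of_nonneg (by positivity)]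
    gcongr
    exact hrε s
  · have := hr s
    rw [abs_of_nonneg (by positivity)]
    refine add_le_add_left ?_ ε
    rw [div_le_div_iff₀ (mul_pos (hpos s) this) hε, one_mul]
    have h1 : ε ^ 2 ≤ ε ^ 2 + s ^ 2 := by nlinarith [sq_nonneg s]
    exact mul_le_mul h1 (hrε s) hε.le (hpos s).le
  · have := hr s
    rw [abs_of_nonneg (by positivity)]
    have h1 : 1 / (√(ε ^ 2 + s ^ 2) + ε) ≤ 1 / ε := by
      gcongr
      linarith
    linarith

/-- Mean value inequality: `|J'(x)| ≤ B |x|`, and `|x| ≤ |s| + |r - s|` on the segment from `s` to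
`r`. -/
theorem IsEntropy.abs_sub_le {J σ τ j : ℝ → ℝ} {B : ℝ} (hE : IsEntropy J σ τ j B) (r s : ℝ) :
    |J r - J s| ≤ B * (2 * |s| + |r - s|) * |r - s| := by
  have hB := hE.nonneg_bound
  refine Convex.norm_image_sub_le_of_norm_hasDerivWithin_le (f := J)
    (f' := fun x => x * σ x) (s := uIcc s r)
    (fun x _ => (hE.hasDerivAt x).hasDerivWithinAt) (fun x hx => ?_) (convex_uIcc s r)
    left_mem_uIcc right_mem_uIcc
  have h1 : |x - s| ≤ |r - s| := abs_sub_left_of_mem_uIcc hx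
  have h2 : |x| ≤ |s| + |x - s| := by
    calc |x| = |s + (x - s)| := by ring_nf
      _ ≤ _ := abs_add_le _ _
  have h3 : |x| ≤ 2 * |s| + |r - s| := by linarith [abs_nonneg s]
  rw [Real.norm_eq_abs, abs_mul, mul_comm]
  exact mul_le_mul (hE.abs_σ_le x) h3 (abs_nonneg _) hB

/-- Young's inequality puts the cross term into a form suited to `L²` convergence: after integration
the first term is small with `κ`, and for fixed `κ` the second tends to `0`. -/
theorem IsEntropy.abs_sub_le_sq {J σ τ j : ℝ → ℝ} {B : ℝ} (hE : IsEntropy J σ τ j B)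
    {κ : ℝ} (hκ : 0 < κ) (r s : ℝ) :
    |J r - J s| ≤ B * κ * s ^ 2 + B * (1 + 1 / κ) * (r - s) ^ 2 := by
  refine (hE.abs_sub_le r s).trans ?_
  have hB := hE.nonneg_bound
  have h1 : 2 * |s| * |r - s| ≤ κ * s ^ 2 + 1 / κ * (r - s) ^ 2 := by
    have h2 : 0 ≤ 1 / κ * (κ * |s| - |r - s|) ^ 2 := by positivity
    have h3 : 1 / κ * (κ * |s| - |r - s|) ^ 2 =
        κ * |s| ^ 2 - 2 * |s| * |r - s| + 1 / κ * |r - s| ^ 2 := by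
      field_simp
      ring
    rw [h3, sq_abs, sq_abs] at h2
    linarith
  calc B * (2 * |s| + |r - s|) * |r - s| = B * (2 * |s| * |r - s| + |r - s| ^ 2) := by ring
    _ ≤ B * (κ * s ^ 2 + 1 / κ * (r - s) ^ 2 + (r - s) ^ 2) := by
        rw [sq_abs]
        gcongr
    _ = _ := by ring

theorem IsEntropy.integrable_mul {α : Type*} [MeasurableSpace α] {μ : Measure α}
    {J σ τ j : ℝ → ℝ} {B : ℝ} (hE : IsEntropy J σ τ j B) {v : α → ℝ} (hv : MemLp v 2 μ) :
    Integrable (fun x => J (v x)) μ := by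
  refine (hv.integrable_sq.const_mul B).mono' (hE.continuous.comp_aestronglyMeasurable hv.1)
    (Eventually.of_forall fun x => ?_)
  rw [hE.eq_mul, Real.norm_eq_abs, abs_mul, ← sq, abs_of_nonneg (sq_nonneg _), mul_comm]
  exact mul_le_mul_of_nonneg_right (hE.abs_j_le _) (sq_nonneg _)

theorem integral_sq_eq_eLpNorm_toReal_sq {α : Type*} [MeasurableSpace α] {μ : Measure α}
    {v : α → ℝ} (hv : MemLp v 2 μ) : ∫ x, v x ^ 2 ∂μ = (eLpNorm v 2 μ).toReal ^ 2 := by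
  have h0 : 0 ≤ ∫ x, v x ^ 2 ∂μ := integral_nonneg fun x => sq_nonneg _
  rw [hv.eLpNorm_eq_integral_rpow_norm (by norm_num) (by norm_num)]
  simp only [ENNReal.toReal_ofNat, Real.rpow_two, Real.norm_eq_abs, sq_abs]
  rw [ENNReal.toReal_ofReal (by positivity), ← Real.rpow_two, ← Real.rpow_mul h0]
  norm_num

/-- The localized entropy of a function in `C⁰([a, b]; L²_loc)` is continuous in time. -/
theorem ContinuousInL2Loc.continuousOn_entropy {N : ℕ} {S : Set ℝ} {u : Sp N × ℝ → ℝ}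
    (hu : ContinuousInL2Loc S u) {J σ τ j : ℝ → ℝ} {B : ℝ} (hE : IsEntropy J σ τ j B)
    {η : Sp N → ℝ} (hη : Continuous η) (hηc : HasCompactSupport η) (hη1 : ∀ x, |η x| ≤ 1) :
    ContinuousOn (fun t => ∫ x, J (u (x, t)) * η x) S := by
  set K := tsupport η with hKdef
  have hK : IsCompact K := hηc.isCompact
  obtain ⟨h1, h2⟩ := hu K hK
  have hB := hE.nonneg_bound
  have hrestr : ∀ t, ∫ x, J (u (x, t)) * η x = ∫ x in K, J (u (x, t)) * η x := fun t => by
    rw [setIntegral_eq_integral_of_forall_compl_eq_zero]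
    intro x hx
    rw [image_eq_zero_of_notMem_tsupport hx, mul_zero]
  simp_rw [hrestr]
  have hi : ∀ t ∈ S, Integrable (fun x => J (u (x, t)) * η x) (volume.restrict K) := fun t ht =>
    (hE.integrable_mul (h1 t ht)).mul_bdd (c := 1) hη.aestronglyMeasurable
      (Eventually.of_forall hη1)
  intro t₀ ht₀
  have hD : Tendsto (fun t => (eLpNorm (fun x => u (x, t) - u (x, t₀)) 2
      (volume.restrict K)).toReal ^ 2) (𝓝[S] t₀) (𝓝 0) := by
    have := ((ENNReal.tendsto_toReal (by simp)).comp (h2 t₀ ht₀)).pow 2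
    simpa using this
  set n := ∫ x in K, u (x, t₀) ^ 2
  have hn : 0 ≤ n := integral_nonneg fun x => sq_nonneg _
  refine Metric.tendsto_nhds.2 fun ε hε => ?_
  -- Chosen so that `B κ n ≤ ε / 2`; the `+ 1` keeps the denominator positive when `B n = 0`.
  set κ := ε / (2 * (B * n + 1)) with hκdef
  have hκ : 0 < κ := by positivity
  have hD' := hD.const_mul (B * (1 + 1 / κ))
  rw [mul_zero] at hD'
  filter_upwards [hD'.eventually (gt_mem_nhds (half_pos hε)), self_mem_nhdsWithin] with t h3 ht
  have hdiff : MemLp (fun x => u (x, t) - u (x, t₀)) 2 (volume.restrict K) :=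
    (h1 t ht).sub (h1 t₀ ht₀)
  rw [← integral_sq_eq_eLpNorm_toReal_sq hdiff] at h3
  rw [Real.dist_eq, ← integral_sub (hi t ht) (hi t₀ ht₀), ← Real.norm_eq_abs]
  have hb : ‖∫ x in K, (J (u (x, t)) * η x - J (u (x, t₀)) * η x)‖ ≤
      ∫ x in K, (B * κ * u (x, t₀) ^ 2 + B * (1 + 1 / κ) * (u (x, t) - u (x, t₀)) ^ 2) := by
    refine norm_integral_le_of_norm_le
      (((h1 t₀ ht₀).integrable_sq.const_mul _).add (hdiff.integrable_sq.const_mul _))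
      (Eventually.of_forall fun x => ?_)
    rw [← sub_mul, norm_mul]
    exact (mul_le_of_le_one_right (norm_nonneg _) (hη1 x)).trans (hE.abs_sub_le_sq hκ _ _)
  rw [integral_add ((h1 t₀ ht₀).integrable_sq.const_mul _) (hdiff.integrable_sq.const_mul _),
    integral_const_mul, integral_const_mul] at hb
  have h5 : B * κ * n ≤ ε / 2 := by
    have : B * κ * n = ε / 2 * (B * n / (B * n + 1)) := by
      rw [hκdef]; field_simp
    rw [this]
    refine mul_le_of_le_one_right (by positivity) ?_
    rw [div_le_one (by positivity)]
    linarith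
  linarith

/-! ### Removing the spatial cutoff -/

/-- Cutoff functions with gradient of the order of the inverse radius. -/
theorem exists_cutoff (N : ℕ) : ∃ C : ℝ, 0 ≤ C ∧ ∀ R : ℝ, 0 < R → ∃ ζ : Sp N → ℝ,
    ContDiff ℝ 1 ζ ∧ HasCompactSupport ζ ∧ (∀ x, 0 ≤ ζ x) ∧ (∀ x, ζ x ≤ 1) ∧
    (∀ x ∈ Metric.closedBall (0 : Sp N) R, ζ x = 1) ∧
    ∀ x i, |fderiv ℝ ζ x (EuclideanSpace.single i 1)| ≤ C / R := by
  -- A fixed bump equal to `1` on the unit ball, rescaled by `R`; the chain rule produces the factor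
  -- `1 / R`.
  let b : ContDiffBump (0 : Sp N) := ⟨1, 2, one_pos, one_lt_two⟩
  have hb : ContDiff ℝ 1 b := b.contDiff
  obtain ⟨C, hC⟩ := (b.hasCompactSupport.fderiv ℝ).exists_bound_of_continuous
    (hb.continuous_fderiv one_ne_zero)
  refine ⟨C, (norm_nonneg _).trans (hC 0), fun R hR => ⟨fun x => b (R⁻¹ • x), ?_, ?_, ?_, ?_, ?_,
    ?_⟩⟩
  · exact hb.comp (contDiff_const_smul _)
  · exact b.hasCompactSupport.comp_homeomorph (Homeomorph.smulOfNeZero R⁻¹ (inv_ne_zero hR.ne'))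
  · exact fun x => b.nonneg
  · exact fun x => b.le_one
  · intro x hx
    refine b.one_of_mem_closedBall ?_
    rw [mem_closedBall_zero_iff] at hx ⊢
    rw [norm_smul, norm_inv, Real.norm_of_nonneg hR.le]
    exact (inv_mul_le_one₀ hR).2 hx
  · intro x i
    have h1 : HasFDerivAt (fun x : Sp N => R⁻¹ • x) (R⁻¹ • ContinuousLinearMap.id ℝ (Sp N)) x :=
      (hasFDerivAt_id x).const_smul R⁻¹
    have h2 := ((hb.differentiable one_ne_zero (R⁻¹ • x)).hasFDerivAt.comp x h1).fderiv
    change |fderiv ℝ (b ∘ fun x => R⁻¹ • x) x _| ≤ _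
    rw [h2]
    have h3 := (fderiv ℝ b (R⁻¹ • x)).le_opNorm (EuclideanSpace.single i (1 : ℝ))
    rw [PiLp.norm_single, norm_one, mul_one] at h3
    simp only [ContinuousLinearMap.comp_apply, _root_.smul_apply,
      ContinuousLinearMap.id_apply, map_smul, smul_eq_mul, abs_mul, abs_inv, abs_of_pos hR]
    rw [div_eq_inv_mul]
    gcongr
    exact h3.trans (hC _)

/-- The entropy of the solution is bounded on every ball by the entropy of the datum. -/
theorem setIntegral_entropy_le {N : ℕ} {p : Fin N → ℝ} (hp : ∀ i, 1 < p i) {T : ℝ} (hT : 0 < T)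
    {Λ : ℝ} (hΛ : 0 < Λ) {A : Sp N × ℝ → ℝ → Sp N → Sp N} (hA : IsAdmissibleField p T Λ A)
    {u₀ : Sp N → ℝ} (hu₀2 : MemLp u₀ 2 volume)
    {u : Sp N × ℝ → ℝ} (hu : SolvesCauchyFinite p A T u₀ u)
    (hup : ∀ i, MemLp u (ENNReal.ofReal (p i)) (volume.restrict (strip N T)))
    {J σ τ j : ℝ → ℝ} {B ε : ℝ} (hE : IsEntropy J σ τ j B) (hε : 0 < ε) (hτ : ∀ s, ε ≤ τ s)
    (hJ : ∀ s, 0 ≤ J s) {t : ℝ} (ht : t ∈ Icc 0 T) (M : ℝ) :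
    ∫ x in Metric.closedBall 0 M, J (u (x, t)) ≤ ∫ x, J (u₀ x) := by
  obtain ⟨⟨G, hsol, hen⟩, hcont, h0⟩ := hu
  -- A single cutoff power dominates all the exponents, so Young's inequality works in every
  -- direction at once.
  obtain ⟨m, hm0, hm⟩ : ∃ m : ℕ, m ≠ 0 ∧ ∀ i, p i ≤ m := by
    obtain ⟨m, hm⟩ := exists_nat_ge (∑ i, |p i|)
    refine ⟨m + 1, by omega, fun i => ?_⟩
    have := Finset.single_le_sum (f := fun i => |p i|) (fun i _ => abs_nonneg _)
      (Finset.mem_univ i)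
    push_cast
    linarith [le_abs_self (p i)]
  obtain ⟨C, hC, hcut⟩ := exists_cutoff N
  let err : ℝ → ℝ := fun R => ∑ i, (ε * Λ⁻¹) ^ (1 - p i) *
    (∫ z in strip N T, (Λ * B * m * |C / R| * |u z|) ^ p i)
  have hB := hE.nonneg_bound
  -- By homogeneity the `i`-th term is `|C / R| ^ p i` times a quantity independent of `R`.
  have herr : Tendsto err atTop (𝓝 0) := by
    have h1 : Tendsto (fun R : ℝ => |C / R|) atTop (𝓝 0) := by
      simpa using (tendsto_const_nhds (x := C)).div_atTop tendsto_id |>.abs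
    have h2 : ∀ i, Tendsto (fun R : ℝ => (ε * Λ⁻¹) ^ (1 - p i) *
        (∫ z in strip N T, (Λ * B * m * |C / R| * |u z|) ^ p i)) atTop (𝓝 0) := by
      intro i
      have hpi : 0 < p i := by linarith [hp i]
      have h3 : ∀ R : ℝ, (ε * Λ⁻¹) ^ (1 - p i) *
        (∫ z in strip N T, (Λ * B * m * |C / R| * |u z|) ^ p i) = |C / R| ^ p i *
        ((ε * Λ⁻¹) ^ (1 - p i) * (Λ * B * m) ^ p i * ∫ z in strip N T, |u z| ^ p i) := by
        intro R
        simp only [← integral_const_mul]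
        refine integral_congr_ae (Eventually.of_forall fun z => ?_)
        dsimp only
        rw [Real.mul_rpow (by positivity) (abs_nonneg _), Real.mul_rpow (by positivity)
          (abs_nonneg _)]
        ring
      simp_rw [h3]
      have h4 := (h1.rpow_const (p := p i) (Or.inr hpi.le)).mul_const
        ((ε * Λ⁻¹) ^ (1 - p i) * (Λ * B * m) ^ p i * ∫ z in strip N T, |u z| ^ p i)
      simpa [Real.zero_rpow hpi.ne'] using h4
    simpa using tendsto_finsetSum Finset.univ fun i _ => h2 i
  have hJ0 : Integrable fun x => J (u₀ x) := hE.integrable_mul hu₀2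
  have hbound : ∀ R, 0 < R → M ≤ R →
      ∫ x in Metric.closedBall 0 M, J (u (x, t)) ≤ (∫ x, J (u₀ x)) + err R := by
    intro R hR hMR
    obtain ⟨ζ, z1, z2, z3, z4, z5, z6⟩ := hcut R hR
    have hηc : HasCompactSupport fun x => ζ x ^ m :=
      z2.comp_left (g := fun r : ℝ => r ^ m) (zero_pow hm0)
    have hη1 : ∀ x, |ζ x ^ m| ≤ 1 := fun x => by
      rw [abs_of_nonneg (pow_nonneg (z3 x) _)]
      exact pow_le_one₀ (z3 x) (z4 x)
    have hηcont : Continuous fun x => ζ x ^ m := z1.continuous.pow m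
    have hmain := le_add_of_weak_derivative (f := fun t => ∫ x, J (u (x, t)) * ζ x ^ m)
      (η := err R) hT (hcont.continuousOn_entropy hE hηcont hηc hη1)
      (fun θ t1 t2 t3 t4 t5 => entropy_inequality hp hT hΛ hA hsol hen hcont hup hE hε hτ hm0 hm
        z1 z2 z3 z4 z6 t1 t2 t3 t4 t5) t ht
    have hK := hηc.isCompact
    have hi : Integrable fun x => J (u (x, t)) * ζ x ^ m := by
      refine IntegrableOn.integrable_of_forall_notMem_eq_zero
        (s := tsupport fun x => ζ x ^ m) ?_ fun x hx => ?_
      · exact (hE.integrable_mul ((hcont _ hK).1 t ht)).mul_bdd (c := 1) hηcont.aestronglyMeasurable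
          (Eventually.of_forall hη1)
      · have : ζ x ^ m = 0 :=
          image_eq_zero_of_notMem_tsupport (f := fun x => ζ x ^ m) hx
        rw [this, mul_zero]
    have hnn : ∀ x, 0 ≤ J (u (x, t)) * ζ x ^ m := fun x =>
      mul_nonneg (hJ _) (pow_nonneg (z3 x) _)
    have hl : ∫ x in Metric.closedBall 0 M, J (u (x, t)) ≤ ∫ x, J (u (x, t)) * ζ x ^ m := by
      calc ∫ x in Metric.closedBall 0 M, J (u (x, t))
          = ∫ x in Metric.closedBall 0 M, J (u (x, t)) * ζ x ^ m := by
            refine setIntegral_congr_fun Metric.isClosed_closedBall.measurableSet fun x hx => ?_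
            simp only [z5 x (Metric.closedBall_subset_closedBall hMR hx), one_pow, mul_one]
        _ ≤ _ := setIntegral_le_integral hi (Eventually.of_forall hnn)
    have hr : ∫ x, J (u (x, 0)) * ζ x ^ m ≤ ∫ x, J (u₀ x) := by
      refine integral_mono_of_nonneg (Eventually.of_forall fun x =>
        mul_nonneg (hJ _) (pow_nonneg (z3 x) _)) hJ0 ?_
      filter_upwards [h0] with x hx
      simp only [hx]
      exact mul_le_of_le_one_right (hJ _) (pow_le_one₀ (z3 x) (z4 x))
    linarith
  -- The limit `R → ∞` is taken with `ε` and `M` fixed.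
  have hlim := herr.const_add (∫ x, J (u₀ x))
  rw [add_zero] at hlim
  refine ge_of_tendsto hlim ?_
  filter_upwards [eventually_gt_atTop 0, eventually_ge_atTop M] with R hR hMR
  exact hbound R hR hMR

/-! ### Passage to the absolute value and conclusion -/

/-- Contraction of the `L¹` norm on a finite time interval. -/
theorem integrable_and_integral_abs_le {N : ℕ} {p : Fin N → ℝ} (hp : ∀ i, 1 < p i) {T : ℝ}
    (hT : 0 < T) {Λ : ℝ} (hΛ : 0 < Λ) {A : Sp N × ℝ → ℝ → Sp N → Sp N}
    (hA : IsAdmissibleField p T Λ A) {u₀ : Sp N → ℝ} (hu₀1 : MemLp u₀ 1 volume)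
    (hu₀2 : MemLp u₀ 2 volume) {u : Sp N × ℝ → ℝ} (hu : SolvesCauchyFinite p A T u₀ u)
    (hup : ∀ i, MemLp u (ENNReal.ofReal (p i)) (volume.restrict (strip N T)))
    {t : ℝ} (ht : t ∈ Icc 0 T) :
    Integrable (fun x => u (x, t)) volume ∧ ∫ x, |u (x, t)| ≤ ∫ x, |u₀ x| := by
  have hu01 : Integrable u₀ := memLp_one_iff_integrable.1 hu₀1
  have hL2 : ∀ M : ℝ, MemLp (fun x => u (x, t)) 2 (volume.restrict (Metric.closedBall 0 M)) :=
    fun M => (hu.2.1 _ (isCompact_closedBall _ _)).1 t ht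
  have hL1 : ∀ M : ℝ, IntegrableOn (fun x => u (x, t)) (Metric.closedBall 0 M) := fun M => by
    have : IsFiniteMeasure ((volume : Measure (Sp N)).restrict (Metric.closedBall 0 M)) :=
      ⟨by simpa using measure_closedBall_lt_top⟩
    exact (hL2 M).integrable (by norm_num)
  have hball : ∀ M : ℝ, ∫ x in Metric.closedBall 0 M, |u (x, t)| ≤ ∫ x, |u₀ x| := by
    intro M
    set V := (volume : Measure (Sp N)).real (Metric.closedBall 0 M)
    -- From `|s| - ε ≤ J_ε(s) ≤ |s| + ε s² / 2`: the lower bound costs `ε V` on the ball, the upper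
    -- one `ε / 2 * ∫ u₀²`.
    have hstep : ∀ ε : ℝ, 0 < ε → ∫ x in Metric.closedBall 0 M, |u (x, t)| ≤
        (∫ x, |u₀ x|) + ε * (1 / 2 * (∫ x, u₀ x ^ 2) + V) := by
      intro ε hε
      have hE := isEntropy_sqrt hε
      have hsq : ∀ s : ℝ, |s| ≤ √(ε ^ 2 + s ^ 2) := fun s =>
        Real.le_sqrt_of_sq_le (by rw [sq_abs]; nlinarith [sq_nonneg ε])
      have hε' : ∀ s : ℝ, ε ≤ √(ε ^ 2 + s ^ 2) := fun s =>
        Real.le_sqrt_of_sq_le (by nlinarith [sq_nonneg s])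
      have hle : ∀ s : ℝ, √(ε ^ 2 + s ^ 2) ≤ ε + |s| := fun s =>
        Real.sqrt_le_iff.2 ⟨by positivity, by
          nlinarith [sq_abs s, mul_nonneg hε.le (abs_nonneg s)]⟩
      have h1 := setIntegral_entropy_le hp hT hΛ hA hu₀2 hu hup hE hε
        (fun s => le_add_of_nonneg_left (by positivity))
        (fun s => add_nonneg (sub_nonneg.2 (hε' s)) (by positivity)) ht M
      have h2 : ∫ x, (√(ε ^ 2 + u₀ x ^ 2) - ε + ε / 2 * u₀ x ^ 2) ≤
          ∫ x, (|u₀ x| + ε / 2 * u₀ x ^ 2) := by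
        refine integral_mono (hE.integrable_mul hu₀2)
          (hu01.abs.add (hu₀2.integrable_sq.const_mul _)) fun x => ?_
        have := hle (u₀ x)
        dsimp only
        linarith
      rw [integral_add hu01.abs (hu₀2.integrable_sq.const_mul _), integral_const_mul] at h2
      have h3 : ∫ x in Metric.closedBall 0 M, (|u (x, t)| - ε) ≤
          ∫ x in Metric.closedBall 0 M,
            (√(ε ^ 2 + u (x, t) ^ 2) - ε + ε / 2 * u (x, t) ^ 2) := by
        refine integral_mono ((hL1 M).abs.sub (integrableOn_const (by
          exact measure_closedBall_lt_top.ne))) (hE.integrable_mul (hL2 M)) fun x => ?_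
        have := hsq (u (x, t))
        have : 0 ≤ ε / 2 * u (x, t) ^ 2 := by positivity
        dsimp only
        linarith
      rw [integral_sub (hL1 M).abs (integrableOn_const (by
          exact measure_closedBall_lt_top.ne)), setIntegral_const, smul_eq_mul] at h3
      have h4 : (volume : Measure (Sp N)).real (Metric.closedBall 0 M) = V := rfl
      rw [h4] at h3
      linarith
    have hlim : Tendsto (fun ε : ℝ => (∫ x, |u₀ x|) + ε * (1 / 2 * (∫ x, u₀ x ^ 2) + V))
        (𝓝[>] 0) (𝓝 ((∫ x, |u₀ x|) + 0 * (1 / 2 * (∫ x, u₀ x ^ 2) + V))) :=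
      (Continuous.tendsto (by fun_prop) 0).mono_left nhdsWithin_le_nhds
    rw [zero_mul, add_zero] at hlim
    exact ge_of_tendsto hlim (eventually_mem_nhdsWithin.mono fun ε hε => hstep ε hε)
  -- The bound is uniform in the radius, so exhausting space by balls yields both integrability and
  -- the inequality.
  have hcov : AECover (volume : Measure (Sp N)) atTop
      fun n : ℕ => Metric.closedBall (0 : Sp N) n :=
    aecover_closedBall tendsto_natCast_atTop_atTop
  have hint : Integrable fun x => u (x, t) :=
    hcov.integrable_of_integral_norm_bounded _ (fun n => hL1 n)
      (Eventually.of_forall fun n => hball n)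
  exact ⟨hint, le_of_tendsto' (hcov.integral_tendsto_of_countably_generated hint.abs)
    fun n => hball n⟩

theorem strip_mono {N : ℕ} {S T : EReal} (h : S ≤ T) : strip N S ⊆ strip N T :=
  fun _ hz => ⟨hz.1, hz.2.trans_le h⟩

end AnisotropicParabolic

theorem mainTheorem7 (N : ℕ) (hN : 1 ≤ N) (p : Fin N → ℝ) (hp : ∀ i, 1 < p i)
    (T : EReal) (hT : 0 < T) (Λ : ℝ) (hΛ : 0 < Λ)
    (A : AnisotropicParabolic.Sp N × ℝ → ℝ → AnisotropicParabolic.Sp N →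
      AnisotropicParabolic.Sp N)
    (hA : AnisotropicParabolic.IsAdmissibleField p T Λ A)
    (u₀ : AnisotropicParabolic.Sp N → ℝ) (hu₀1 : MemLp u₀ 1 volume) (hu₀2 : MemLp u₀ 2 volume)
    (u : AnisotropicParabolic.Sp N × ℝ → ℝ)
    (hu : AnisotropicParabolic.SolvesCauchy p A T u₀ u)
    (hup : ∀ i, MemLp u (ENNReal.ofReal (p i))
      (volume.restrict (AnisotropicParabolic.strip N T))) :
    ∀ t : ℝ, 0 ≤ t → (t : EReal) ≤ T →
      Integrable (fun x => u (x, t)) volume ∧ ∫ x, |u (x, t)| ≤ ∫ x, |u₀ x| := by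
  intro t ht0 htT
  -- For finite `T` the choice `τ = T` includes the final time `t = T`; for `T = ⊤` any finite time
  -- beyond `t` will do.
  obtain ⟨τ, hτ, hτT, htτ, hsol⟩ : ∃ τ : ℝ, 0 < τ ∧ (τ : EReal) ≤ T ∧ t ≤ τ ∧
      AnisotropicParabolic.SolvesCauchyFinite p A τ u₀ u := by
    by_cases h : T = ⊤
    · exact ⟨t + 1, by linarith, by simp [h], by linarith, hu.2 h _ (by linarith)⟩
    · have hc : ((T.toReal : ℝ) : EReal) = T :=
        EReal.coe_toReal h (lt_of_le_of_lt bot_le hT).ne'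
      refine ⟨T.toReal, ?_, hc.le, ?_, hu.1 h⟩
      · rw [← hc] at hT
        exact_mod_cast hT
      · rw [← hc] at htT
        exact_mod_cast htT
  have hs := AnisotropicParabolic.strip_mono (N := N) hτT
  exact AnisotropicParabolic.integrable_and_integral_abs_le hp hτ hΛ
    ⟨hA.measurable, ae_mono (Measure.restrict_mono hs le_rfl) hA.growth⟩ hu₀1 hu₀2 hsol
    (fun i => (hup i).mono_measure (Measure.restrict_mono hs le_rfl)) ⟨ht0, htτ⟩
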